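/- Let $\mu$ be a $\sigma$-finite measure on a sample space $\mathcal X$ (for instance Lebesgue measure), let $g$ and $f_\theta$, $\theta\in\Theta\subseteq\mathbb R^p$, be probability densities with respect to $\mu$, and let $X_1,X_2,\dots$ be independent with common distribution $G=g\,d\mu$. Fix tuning parameters $\alpha\in\mathbb R$, $\beta\in[0,1]$, $\gamma\ge 0$, and put $$B(y)=\beta\,\frac{e^{\alpha y}-1-\alpha y}{\alpha^2}+(1-\beta)\,\frac{y^{\gamma+1}-y}{\gamma},$$ where the first fraction is read as its limit $y^2/2$ if $\alpha=0$ and the second one as its limit $y\log y$ if $\gamma=0$ (and $B'$ is read accordingly). Let $u_\theta=\nabla_\theta\log f_\theta$, $i_\theta=-\nabla_\theta u_\theta$, $w_\theta=\beta f_\theta e^{\alpha f_\theta}+(1-\beta)(\gamma+1)f_\theta^{\gamma}$, $T_\theta=u_\theta w_\theta$, $\psi(x,\theta)=T_\theta(x)-\int T_\theta f_\theta\,d\mu$, and $$V_\theta(x)=\int\{B'(f_\theta)f_\theta-B(f_\theta)\}\,d\mu-B'(f_\theta(x)).$$ Let $\theta^g$ be the best fitting parameter, i.e. a solution $\theta=\theta^g$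 of $\int T_\theta\, g\,d\mu=\int T_\theta f_\theta\,d\mu$. Assume: (A1) $\{f_\theta>0\}=\{g>0\}=\chi$ for all $\theta\in\Theta$. (A2) There is an open set $\omega\subseteq\Theta$ with $\theta^g\in\omega$ such that, for almost all $x\in\chi$, $\theta\mapsto f_\theta(x)$ is three times differentiable on $\omega$ with continuous third partial derivatives. (A3) On $\omega$ the integrals $\int\{B'(f_\theta)f_\theta-B(f_\theta)\}\,d\mu$ and $\int B'(f_\theta)\,g\,d\mu$ exist and can be differentiated three times with respect to $\theta$, and the derivatives can be taken under the integral sign. (A4) The matrix $\big(E_g[\nabla_{kl}V_\theta(X)]\big)_{k,l}$ is positive definite at $\theta=\theta^g$. (A5) There are functions $M_{jkl}$ with $E_g[M_{jkl}(X)]<\infty$ such that, for almost all $x\in\chi$, $|\nabla_{jkl}V_\theta(x)|\le M_{jkl}(x)$ for all $\theta\in\omega$. Define $\xi(\theta)=\int u_\theta w_\theta\, g\,d\mu$, $K(\theta)=\int u_\theta u_\theta^T w_\theta^2\, g\,d\mu-\xi(\theta)\xi(\theta)^T$ and $$\begin{aligned}J(\theta)=\int\Big[&\beta f_\theta^2e^{\alpha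 f_\theta}u_\theta u_\theta^T+(1-\beta)(\gamma+1)f_\theta^{\gamma+1}u_\theta u_\theta^T+(1-\beta)(\gamma+1)(g-f_\theta)\{i_\theta-\gamma u_\theta u_\theta^T\}f_\theta^\gamma\\&+\beta(g-f_\theta)\{i_\theta-u_\theta u_\theta^T\}f_\theta e^{\alpha f_\theta}-\alpha\beta(g-f_\theta)f_\theta^2e^{\alpha f_\theta}u_\theta u_\theta^T\Big]d\mu .\end{aligned}$$ Then: (a) The estimating equation $\sum_{i=1}^n\psi(X_i,\theta)=0$, $\theta\in\Theta$, has a consistent sequence of roots: there are measurable functions $\hat\theta_n=\hat\theta_n(X_1,\dots,X_n)$ that solve it with probability tending to $1$ as $n\to\infty$ and converge to $\theta^g$ in probability. (b) Suppose that $K(\theta^g)$ exists, i.e. that the entries of $u_{\theta^g}u_{\theta^g}^Tw_{\theta^g}^2\,g$ are $\mu$-integrable. Write $J=J(\theta^g)$ and $K=K(\theta^g)$. Then $J$ is invertible, $J^{-1}KJ^{-1}$ is positive semidefinite, and for every consistent sequence of roots $\hat\theta_n$ (random vectors that solve the equation with probability tending to $1$ and converge to $\theta^g$ in probability), $\sqrt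 n(\hat\theta_n-\theta^g)$ converges in distribution to the multivariate normal law with mean $0$ and covariance matrix $J^{-1}KJ^{-1}$. -/

import Mathlib

open MeasureTheory ProbabilityTheory Filter Topology Matrix

noncomputable section

/-! ### The generating function of the exponential-polynomial divergence -/

/-- The convex generating function
`B(y) = β (e^{α y} - 1 - α y) / α² + (1 - β) (y^{γ+1} - y) / γ`,
with its limits `β y² / 2` for the first summand when `α = 0` and `(1 - β) y log y` for the second
one when `γ = 0`. -/
def epdB (α β γ : ℝ) (y : ℝ) : ℝ :=
  β * (if α = 0 then y ^ 2 / 2 else (Real.exp (α * y) - 1 - α * y) / α ^ 2) +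
    (1 - β) * (if γ = 0 then y * Real.log y else (y ^ (γ + 1) - y) / γ)

/-- The derivative `B'` of `epdB`, see `hasDerivAt_epdB`. -/
def epdB' (α β γ : ℝ) (y : ℝ) : ℝ :=
  β * (if α = 0 then y else (Real.exp (α * y) - 1) / α) +
    (1 - β) * (if γ = 0 then Real.log y + 1 else ((γ + 1) * y ^ γ - 1) / γ)

theorem hasDerivAt_epdB (α β γ : ℝ) {y : ℝ} (hy : 0 < y) :
    HasDerivAt (epdB α β γ) (epdB' α β γ y) y := by
  unfold epdB epdB'
  refine HasDerivAt.add (HasDerivAt.const_mul β ?_) (HasDerivAt.const_mul (1 - β) ?_)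
  · split_ifs with h
    · have := (hasDerivAt_pow 2 y).div_const 2
      simpa using this
    · have h1 : HasDerivAt (fun z : ℝ => α * z) α y := by
        simpa using (hasDerivAt_id y).const_mul α
      have h2 := ((h1.exp.sub_const 1).sub h1).div_const (α ^ 2)
      have h3 : (Real.exp (α * y) * α - α) / α ^ 2 = (Real.exp (α * y) - 1) / α := by
        field_simp
      rw [← h3]
      exact h2
  · split_ifs with h
    · have := (hasDerivAt_id y).mul (Real.hasDerivAt_log hy.ne')
      have h3 : 1 * Real.log y + id y * y⁻¹ = Real.log y + 1 := by
        simp [hy.ne']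
      rw [← h3]
      exact this
    · have h1 := (Real.hasDerivAt_rpow_const (p := γ + 1) (Or.inl hy.ne')).sub (hasDerivAt_id y)
      have h2 := h1.div_const γ
      simpa using h2

/-- The weight `w(y) = B''(y) y = β y e^{α y} + (1 - β) (γ + 1) y^γ`. -/
def epdWeight (α β γ : ℝ) (y : ℝ) : ℝ :=
  β * y * Real.exp (α * y) + (1 - β) * (γ + 1) * y ^ γ

/-! ### Densities, score and information function -/

variable {p : ℕ} {𝒳 : Type*} [MeasurableSpace 𝒳]

/-- `h` is a probability density with respect to `μ`. -/
structure IsProbDensity (μ : Measure 𝒳) (h : 𝒳 → ℝ) : Prop where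
  measurable : Measurable h
  nonneg : ∀ x, 0 ≤ h x
  lintegral_eq_one : ∫⁻ x, ENNReal.ofReal (h x) ∂μ = 1

/-- The `k`-th vector of the standard basis of `ℝ^p`. -/
abbrev stdVec (k : Fin p) : EuclideanSpace ℝ (Fin p) := EuclideanSpace.single k 1

/-- The likelihood score `u_θ(x) = ∇_θ log f_θ(x)`. -/
def score (f : EuclideanSpace ℝ (Fin p) → 𝒳 → ℝ) (θ : EuclideanSpace ℝ (Fin p)) (x : 𝒳) :
    EuclideanSpace ℝ (Fin p) :=
  gradient (fun t => Real.log (f t x)) θ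

/-- The information function `i_θ(x) = -∇_θ u_θ(x)`, a `p × p` matrix. -/
def infoMatrix (f : EuclideanSpace ℝ (Fin p) → 𝒳 → ℝ) (θ : EuclideanSpace ℝ (Fin p)) (x : 𝒳) :
    Matrix (Fin p) (Fin p) ℝ :=
  Matrix.of fun k l => -(fderiv ℝ (fun t => score f t x k) θ (stdVec l))

/-! ### Objective function and estimating function -/

/-- `T_θ(x) = u_θ(x) {β f_θ(x) e^{α f_θ(x)} + (1 - β) (γ + 1) f_θ(x)^γ}`. -/
def epdT (α β γ : ℝ) (f : EuclideanSpace ℝ (Fin p) → 𝒳 → ℝ) (θ : EuclideanSpace ℝ (Fin p))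
    (x : 𝒳) : EuclideanSpace ℝ (Fin p) :=
  epdWeight α β γ (f θ x) • score f θ x

/-- `ψ(x, θ) = T_θ(x) - E_{f_θ}[T_θ(X)]`. -/
def epdPsi (μ : Measure 𝒳) (α β γ : ℝ) (f : EuclideanSpace ℝ (Fin p) → 𝒳 → ℝ) (x : 𝒳)
    (θ : EuclideanSpace ℝ (Fin p)) : EuclideanSpace ℝ (Fin p) :=
  epdT α β γ f θ x - ∫ y, f θ y • epdT α β γ f θ y ∂μ

/-- `V_θ(x) = ∫ {B'(f_θ) f_θ - B(f_θ)} dμ - B'(f_θ(x))`. -/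
def epdV (μ : Measure 𝒳) (α β γ : ℝ) (f : EuclideanSpace ℝ (Fin p) → 𝒳 → ℝ)
    (θ : EuclideanSpace ℝ (Fin p)) (x : 𝒳) : ℝ :=
  (∫ y, (epdB' α β γ (f θ y) * f θ y - epdB α β γ (f θ y)) ∂μ) - epdB' α β γ (f θ x)

/-- The second partial derivative `∇_{kl} V_θ(x)` with respect to `θ`. -/
def epdV₂ (μ : Measure 𝒳) (α β γ : ℝ) (f : EuclideanSpace ℝ (Fin p) → 𝒳 → ℝ)
    (θ : EuclideanSpace ℝ (Fin p)) (k l : Fin p) (x : 𝒳) : ℝ :=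
  iteratedFDeriv ℝ 2 (fun t => epdV μ α β γ f t x) θ ![stdVec k, stdVec l]

/-- The third partial derivative `∇_{jkl} V_θ(x)` with respect to `θ`. -/
def epdV₃ (μ : Measure 𝒳) (α β γ : ℝ) (f : EuclideanSpace ℝ (Fin p) → 𝒳 → ℝ)
    (θ : EuclideanSpace ℝ (Fin p)) (j k l : Fin p) (x : 𝒳) : ℝ :=
  iteratedFDeriv ℝ 3 (fun t => epdV μ α β γ f t x) θ ![stdVec j, stdVec k, stdVec l]

/-- The matrix `E_g[∇_{kl} V_θ(X)]`. -/
def epdExpHessian (μ : Measure 𝒳) (α β γ : ℝ) (f : EuclideanSpace ℝ (Fin p) → 𝒳 → ℝ) (g : 𝒳 → ℝ)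
    (θ : EuclideanSpace ℝ (Fin p)) : Matrix (Fin p) (Fin p) ℝ :=
  Matrix.of fun k l => ∫ x, epdV₂ μ α β γ f θ k l x * g x ∂μ

/-- On `ω`, the integral `θ ↦ ∫ h_θ dμ` can be differentiated three times and the derivatives can
be taken under the integral sign (derivatives are tested on arbitrary vectors `v`, so that only
integrals of real functions occur). -/
structure DiffThriceUnderIntegral (μ : Measure 𝒳) (h : EuclideanSpace ℝ (Fin p) → 𝒳 → ℝ)
    (ω : Set (EuclideanSpace ℝ (Fin p))) : Prop where
  integrable : ∀ k ≤ 3, ∀ θ ∈ ω, ∀ v : Fin k → EuclideanSpace ℝ (Fin p),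
    Integrable (fun x => iteratedFDeriv ℝ k (fun t => h t x) θ v) μ
  differentiableOn : ∀ k < 3,
    DifferentiableOn ℝ (iteratedFDeriv ℝ k (fun t => ∫ x, h t x ∂μ)) ω
  iteratedFDeriv_integral : ∀ k ≤ 3, ∀ θ ∈ ω, ∀ v : Fin k → EuclideanSpace ℝ (Fin p),
    iteratedFDeriv ℝ k (fun t => ∫ x, h t x ∂μ) θ v =
      ∫ x, iteratedFDeriv ℝ k (fun t => h t x) θ v ∂μ

/-! ### The matrices `J` and `K` -/

/-- `ξ(θ) = ∫ u_θ {β f_θ e^{α f_θ} + (1 - β) (γ + 1) f_θ^γ} g dμ`. -/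
def epdXi (μ : Measure 𝒳) (α β γ : ℝ) (f : EuclideanSpace ℝ (Fin p) → 𝒳 → ℝ) (g : 𝒳 → ℝ)
    (θ : EuclideanSpace ℝ (Fin p)) : Fin p → ℝ :=
  fun k => ∫ x, score f θ x k * epdWeight α β γ (f θ x) * g x ∂μ

/-- `K(θ) = ∫ u_θ u_θᵀ {β f_θ e^{α f_θ} + (1 - β) (γ + 1) f_θ^γ}² g dμ - ξ(θ) ξ(θ)ᵀ`. -/
def epdK (μ : Measure 𝒳) (α β γ : ℝ) (f : EuclideanSpace ℝ (Fin p) → 𝒳 → ℝ) (g : 𝒳 → ℝ)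
    (θ : EuclideanSpace ℝ (Fin p)) : Matrix (Fin p) (Fin p) ℝ :=
  Matrix.of fun k l =>
    (∫ x, score f θ x k * score f θ x l * epdWeight α β γ (f θ x) ^ 2 * g x ∂μ) -
      epdXi μ α β γ f g θ k * epdXi μ α β γ f g θ l

/-- The five integrands (entry `(k, l)`, at the point `x`) in the formula for `J(θ)`. -/
def epdJTerm (α β γ : ℝ) (f : EuclideanSpace ℝ (Fin p) → 𝒳 → ℝ) (g : 𝒳 → ℝ)
    (θ : EuclideanSpace ℝ (Fin p)) (k l : Fin p) (x : 𝒳) : Fin 5 → ℝ :=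
  ![β * (f θ x ^ 2 * Real.exp (α * f θ x) * (score f θ x k * score f θ x l)),
    (1 - β) * (γ + 1) * (f θ x ^ (γ + 1) * (score f θ x k * score f θ x l)),
    (1 - β) * (γ + 1) * ((g x - f θ x) *
      ((infoMatrix f θ x k l - γ * (score f θ x k * score f θ x l)) * f θ x ^ γ)),
    β * ((g x - f θ x) * (infoMatrix f θ x k l - score f θ x k * score f θ x l) *
      (f θ x * Real.exp (α * f θ x))),
    -(α * β * ((g x - f θ x) * f θ x ^ 2 * Real.exp (α * f θ x) *
      (score f θ x k * score f θ x l)))]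

/-- The matrix `J(θ)`: the five integrals are written as the integral of the sum, which makes sense
even where the single integrals do not exist and agrees with their sum where they do, see
`epdJ_apply_eq_sum`. -/
def epdJ (μ : Measure 𝒳) (α β γ : ℝ) (f : EuclideanSpace ℝ (Fin p) → 𝒳 → ℝ) (g : 𝒳 → ℝ)
    (θ : EuclideanSpace ℝ (Fin p)) : Matrix (Fin p) (Fin p) ℝ :=
  Matrix.of fun k l => ∫ x, ∑ i, epdJTerm α β γ f g θ k l x i ∂μ

theorem epdJ_apply_eq_sum (μ : Measure 𝒳) (α β γ : ℝ) (f : EuclideanSpace ℝ (Fin p) → 𝒳 → ℝ)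
    (g : 𝒳 → ℝ) (θ : EuclideanSpace ℝ (Fin p)) (k l : Fin p)
    (h : ∀ i, Integrable (fun x => epdJTerm α β γ f g θ k l x i) μ) :
    epdJ μ α β γ f g θ k l = ∑ i, ∫ x, epdJTerm α β γ f g θ k l x i ∂μ := by
  simp only [epdJ, Matrix.of_apply]
  exact integral_finsetSum _ fun i _ => h i

/-! ### Consistent sequences of roots -/

/-- `θhat n` (a random vector for each sample size `n`) is a consistent sequence of roots of the
estimating equation `∑_{i < n} ψ(X_i, θ) = 0`, `θ ∈ Θ`: with probability tending to one `θhat n` is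
a root, and `θhat n` converges to `θ₀` in probability. -/
structure IsConsistentRootSeq {Ω : Type*} [MeasurableSpace Ω] (P : Measure Ω)
    (X : ℕ → Ω → 𝒳) (Θ : Set (EuclideanSpace ℝ (Fin p)))
    (ψ : 𝒳 → EuclideanSpace ℝ (Fin p) → EuclideanSpace ℝ (Fin p))
    (θ₀ : EuclideanSpace ℝ (Fin p)) (θhat : ℕ → Ω → EuclideanSpace ℝ (Fin p)) : Prop where
  root : Tendsto (fun n => P {w | ¬ (θhat n w ∈ Θ ∧
    ∑ i ∈ Finset.range n, ψ (X i w) (θhat n w) = 0)}) atTop (𝓝 0)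
  consistent : TendstoInMeasure P θhat atTop (fun _ => θ₀)

end

/-!
Up to sign the estimating function `ψ(x, θ)` is the gradient in `θ` of the objective `V_θ(x)`:
with `T_θ = w(f_θ) u_θ` one has `∇ B'(f_θ) = T_θ` and `∇ {B'(f_θ) f_θ - B(f_θ)} = f_θ T_θ`
(`IsSmoothModelAt.fderiv_epdB'`, `IsSmoothModelAt.fderiv_integrand`, `fderiv_epdV`). Differentiating
once more under the integral sign identifies `J` with the transpose of the expected Hessian of `V`
(`epdJ_eq_transpose_epdExpHessian`), so `J` is symmetric and positive definite by assumption, while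
`K` is the covariance matrix of `ψ(X, θ^g)` (`integral_inner_epdPsi_sq`), which has mean zero.

The dominated third derivatives of `V` enter only through one inequality: near `θ₀ = θ^g` the map
`ψ(x, ·)` is linear with derivative `H(x)`, up to an error `M(x) ρ ‖θ - θ'‖` on the ball of radius
`ρ`, where `H` and `M` are integrable and `E H = A = -J` is invertible
(`RegularEstimatingFunction`, `exists_regularEstimatingFunction`). This inequality passes to the
sample mean `Ψ_n` of `ψ(X_i, ·)`, and the rest holds for every estimating function of this kind.

*Existence of roots.* By the law of large numbers the derivative of `Ψ_n` is close to `A` on a small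
ball and `Ψ_n(θ₀)` is close to `0`, with probability tending to one. Then the simplified Newton
iteration `θ ↦ θ - A⁻¹ Ψ_n(θ)` is a contraction of the ball, and its iterates from `θ₀` converge to
a root within distance `2 ‖A⁻¹ Ψ_n(θ₀)‖` of `θ₀` (`exists_zero_of_nearly_linear`). As a limit of
measurable functions of the sample the root is measurable, so that no selection theorem is needed
(`RegularEstimatingFunction.exists_consistent_roots`).

*Asymptotic normality.* At a root `θ̂_n` near `θ₀` the same inequality gives
`‖θ̂_n - θ₀ + A⁻¹ Ψ_n(θ₀)‖ ≤ R_n ‖θ̂_n - θ₀‖` with `R_n → 0` in probability. Hence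
`√n (θ̂_n - θ₀)` and `-√n A⁻¹ Ψ_n(θ₀)` have the same limit law by Slutsky's theorem
(`RegularEstimatingFunction.tendstoInDistribution_of_roots`), and the latter is normal with
covariance matrix `J⁻¹ K J⁻¹` by the multivariate central limit theorem
(`tendstoInDistribution_sqrt_smul_sampleMean`).
-/

/-! ### Events of probability tending to one -/

section HighProbability

variable {Ω : Type*} [MeasurableSpace Ω] {P : Measure Ω}

/-- The events `A n` have probability tending to one: the outer measure of the complement of `A n`
tends to zero, so that no measurability is required. -/
def WithHighProb (P : Measure Ω) (A : ℕ → Ω → Prop) : Prop :=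
  Tendsto (fun n => P {w | ¬ A n w}) atTop (𝓝 0)

namespace WithHighProb

variable {A B : ℕ → Ω → Prop}

theorem mono (hA : WithHighProb P A) (h : ∀ n w, A n w → B n w) : WithHighProb P B :=
  tendsto_of_tendsto_of_tendsto_of_le_of_le tendsto_const_nhds hA (fun _ => zero_le)
    fun n => measure_mono fun w hw hAw => hw (h n w hAw)

theorem and (hA : WithHighProb P A) (hB : WithHighProb P B) :
    WithHighProb P fun n w => A n w ∧ B n w := by
  have h : Tendsto (fun n => P {w | ¬ A n w} + P {w | ¬ B n w}) atTop (𝓝 0) := by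
    simpa using Tendsto.add hA hB
  refine tendsto_of_tendsto_of_tendsto_of_le_of_le tendsto_const_nhds h (fun _ => zero_le)
    fun n => (measure_mono fun w hw => ?_).trans (measure_union_le _ _)
  exact not_and_or.1 hw

theorem of_ae (h : ∀ᵐ w ∂P, ∀ n, A n w) : WithHighProb P A := by
  have h0 : ∀ n, P {w | ¬ A n w} = 0 := fun n => ae_iff.1 (h.mono fun w hw => hw n)
  simp [WithHighProb, h0]

theorem eventually (h : ∀ᶠ n in atTop, ∀ w, A n w) : WithHighProb P A := by
  refine tendsto_const_nhds.congr' ?_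
  filter_upwards [h] with n hn
  simp [hn]

end WithHighProb

theorem tendstoInMeasure_iff_withHighProb {E : Type*} [SeminormedAddCommGroup E] {f : ℕ → Ω → E}
    {g : Ω → E} : TendstoInMeasure P f atTop g ↔
      ∀ ε > 0, WithHighProb P fun n w => ‖f n w - g w‖ < ε := by
  simp only [tendstoInMeasure_iff_norm, WithHighProb, not_lt, gt_iff_lt]

theorem TendstoInMeasure.withHighProb {E : Type*} [SeminormedAddCommGroup E] {f : ℕ → Ω → E}
    {g : Ω → E} (h : TendstoInMeasure P f atTop g) {ε : ℝ} (hε : 0 < ε) :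
    WithHighProb P fun n w => ‖f n w - g w‖ < ε :=
  tendstoInMeasure_iff_withHighProb.1 h ε hε

/-- Convergence in distribution to a constant implies convergence in probability; stated for real
random variables and the constant zero. -/
theorem TendstoInDistribution.tendstoInMeasure_zero [IsProbabilityMeasure P] {Ω' : Type*}
    [MeasurableSpace Ω'] {P' : Measure Ω'} [IsProbabilityMeasure P'] {Y : ℕ → Ω → ℝ}
    (h : TendstoInDistribution Y atTop (fun _ : Ω' => (0 : ℝ)) (fun _ => P) P') :
    TendstoInMeasure P Y atTop fun _ => 0 := by
  rw [tendstoInMeasure_iff_norm]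
  intro ε hε
  have hcl : IsClosed {y : ℝ | ε ≤ ‖y‖} := isClosed_le continuous_const continuous_norm
  have hlim := ProbabilityMeasure.limsup_measure_closed_le_of_tendsto h.tendsto hcl
  have hY : ∀ n, P {w | ε ≤ ‖Y n w - 0‖} = P.map (Y n) {y : ℝ | ε ≤ ‖y‖} := fun n => by
    rw [Measure.map_apply_of_aemeasurable (h.forall_aemeasurable n) hcl.measurableSet]
    simp
  have h0 : P'.map (fun _ : Ω' => (0 : ℝ)) {y : ℝ | ε ≤ ‖y‖} = 0 := by
    rw [Measure.map_apply measurable_const hcl.measurableSet]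
    simp [not_le.2 hε]
  simp only [ProbabilityMeasure.coe_mk] at hlim
  simp_rw [hY]
  refine tendsto_of_le_liminf_of_limsup_le zero_le ?_
  refine le_trans ?_ (hlim.trans h0.le)
  rfl

end HighProbability

/-! ### Limit theorems for independent observations with a common law -/

section LimitTheorems

variable {𝒳 : Type*} [MeasurableSpace 𝒳] {ν : Measure 𝒳} {Ω : Type*} [MeasurableSpace Ω]
  {P : Measure Ω} {X : ℕ → Ω → 𝒳}

/-- The mean `n⁻¹ ∑_{i < n} φ(X_i)` of a function of the first `n` observations. -/
noncomputable def sampleMean {F : Type*} [AddCommMonoid F] [Module ℝ F] (X : ℕ → Ω → 𝒳)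
    (φ : 𝒳 → F) (n : ℕ) (w : Ω) : F :=
  (n : ℝ)⁻¹ • ∑ i ∈ Finset.range n, φ (X i w)

theorem aemeasurable_sampleMean {F : Type*} [NormedAddCommGroup F] [NormedSpace ℝ F]
    [MeasurableSpace F] [BorelSpace F] [SecondCountableTopology F]
    (hlaw : ∀ i, HasLaw (X i) ν P) {φ : 𝒳 → F} (hφ : AEMeasurable φ ν) (n : ℕ) :
    AEMeasurable (sampleMean X φ n) P := by
  refine AEMeasurable.const_smul (Finset.aemeasurable_fun_sum _ fun i _ => ?_) _
  refine AEMeasurable.comp_aemeasurable (g := φ) ?_ (hlaw i).aemeasurable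
  rwa [(hlaw i).map_eq]

theorem identDistrib_comp_of_hasLaw {F : Type*} [MeasurableSpace F]
    (hlaw : ∀ i, HasLaw (X i) ν P) {φ : 𝒳 → F} (hφ : AEMeasurable φ ν) (i : ℕ) :
    IdentDistrib (fun w => φ (X i w)) (fun w => φ (X 0 w)) P P := by
  refine ((hlaw i).identDistrib (hlaw 0)).comp_of_aemeasurable (u := φ) ?_
  rwa [(hlaw i).map_eq]

theorem iIndepFun_comp_of_hasLaw {F : Type*} [MeasurableSpace F] (hindep : iIndepFun X P)
    (hlaw : ∀ i, HasLaw (X i) ν P) {φ : 𝒳 → F} (hφ : AEMeasurable φ ν) :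
    iIndepFun (fun i w => φ (X i w)) P :=
  hindep.comp₀ (fun _ => φ) (fun i => (hlaw i).aemeasurable) fun i => by rwa [(hlaw i).map_eq]

/-- The weak law of large numbers for a function of the observations. -/
theorem tendstoInMeasure_sampleMean [IsProbabilityMeasure P] {F : Type*} [NormedAddCommGroup F] [NormedSpace ℝ F]
    [MeasurableSpace F] [BorelSpace F] [SecondCountableTopology F] [CompleteSpace F]
    (hindep : iIndepFun X P) (hlaw : ∀ i, HasLaw (X i) ν P) {φ : 𝒳 → F}
    (hφ : Integrable φ ν) :
    TendstoInMeasure P (sampleMean X φ) atTop fun _ => ∫ x, φ x ∂ν := by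
  have hm : AEMeasurable φ ν := hφ.aestronglyMeasurable.aemeasurable
  refine tendstoInMeasure_of_tendsto_ae
    (fun n => (aemeasurable_sampleMean hlaw hm n).aestronglyMeasurable) ?_
  have hint : Integrable (fun w => φ (X 0 w)) P := by
    have h := hφ
    rw [← (hlaw 0).map_eq] at h
    exact h.comp_aemeasurable (hlaw 0).aemeasurable
  have h := strong_law_ae (fun i w => φ (X i w)) hint
    (fun i j hij => (iIndepFun_comp_of_hasLaw hindep hlaw hm).indepFun hij)
    (identDistrib_comp_of_hasLaw hlaw hm)
  have hE : P[fun w => φ (X 0 w)] = ∫ x, φ x ∂ν :=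
    (hlaw 0).integral_comp hφ.aestronglyMeasurable
  rwa [hE] at h

/-- **Multivariate central limit theorem**, deduced from the one-dimensional one for the functions
`⟪ζ, t⟫` by means of characteristic functions. -/
theorem tendstoInDistribution_sqrt_smul_sampleMean [IsProbabilityMeasure P] {p : ℕ}
    (hindep : iIndepFun X P)
    (hlaw : ∀ i, HasLaw (X i) ν P) {ζ : 𝒳 → EuclideanSpace ℝ (Fin p)} (hζ : MemLp ζ 2 ν)
    (hmean : ∫ x, ζ x ∂ν = 0) {S : Matrix (Fin p) (Fin p) ℝ} (hS : S.PosSemidef)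
    (hcov : ∀ t : EuclideanSpace ℝ (Fin p), ∫ x, inner ℝ (ζ x) t ^ 2 ∂ν = t ⬝ᵥ S *ᵥ t) :
    TendstoInDistribution (fun (n : ℕ) w => √(n : ℝ) • sampleMean X ζ n w) atTop id (fun _ => P)
      (multivariateGaussian 0 S) := by
  have hm : AEMeasurable ζ ν := hζ.aestronglyMeasurable.aemeasurable
  have hνp : IsProbabilityMeasure ν := (hlaw 0).isProbabilityMeasure_iff.1 inferInstance
  have hmeas : ∀ n : ℕ, AEMeasurable (fun w => √(n : ℝ) • sampleMean X ζ n w) P :=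
    fun n => (aemeasurable_sampleMean hlaw hm n).fun_const_smul _
  refine ⟨hmeas, aemeasurable_id, ?_⟩
  refine ProbabilityMeasure.tendsto_iff_tendsto_charFun.2 fun t => ?_
  simp only [ProbabilityMeasure.coe_mk, Measure.map_id]
  set η : 𝒳 → ℝ := fun x => inner ℝ (ζ x) t with hη
  have hηL : MemLp η 2 ν := hζ.inner_const t
  have hηm : AEMeasurable η ν := hηL.aestronglyMeasurable.aemeasurable
  have hη0 : ∫ x, η x ∂ν = 0 := by
    have h := integral_inner (𝕜 := ℝ) (hζ.integrable (by norm_num)) t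
    simp only [hη, real_inner_comm t] at h ⊢
    rw [h, hmean, inner_zero_right]
  have hP0 : ∫ w, η (X 0 w) ∂P = 0 :=
    ((hlaw 0).integral_comp hηL.aestronglyMeasurable).trans hη0
  have hL0 : MemLp (fun w => η (X 0 w)) 2 P := by
    have h := hηL
    rw [← (hlaw 0).map_eq] at h
    exact h.comp_of_map (hlaw 0).aemeasurable
  have hvar : Var[fun w => η (X 0 w); P] = t ⬝ᵥ S *ᵥ t := by
    rw [variance_eq_integral hL0.aestronglyMeasurable.aemeasurable, hP0, ← hcov t]
    simp only [sub_zero]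
    exact (hlaw 0).integral_comp (f := fun x => η x ^ 2) (hηm.pow_const 2).aestronglyMeasurable
  have hclt := tendstoInDistribution_inv_sqrt_mul_sum_sub (P := P)
    (P' := gaussianReal 0 (Var[fun w => η (X 0 w); P]).toNNReal) (Y := id)
    (X := fun i w => η (X i w)) HasLaw.id hL0
    (iIndepFun_comp_of_hasLaw hindep hlaw hηm) (identDistrib_comp_of_hasLaw hlaw hηm)
  have h1 := ProbabilityMeasure.tendsto_iff_tendsto_charFun.1 hclt.tendsto 1
  simp only [ProbabilityMeasure.coe_mk, Measure.map_id] at h1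
  have hlimit : charFun (gaussianReal 0 (Var[fun w => η (X 0 w); P]).toNNReal) 1 =
      charFun (multivariateGaussian 0 S) t := by
    rw [charFun_multivariateGaussian hS, charFun_gaussianReal, ← hvar,
      Real.coe_toNNReal _ (variance_nonneg _ _)]
    simp
  rw [hlimit] at h1
  refine h1.congr fun n => ?_
  rw [charFun_apply, charFun_apply, integral_map (hmeas n) (by fun_prop),
    integral_map (hclt.forall_aemeasurable n) (by fun_prop)]
  congr 1
  ext w
  have hsq : √(n : ℝ) * (n : ℝ)⁻¹ = (√(n : ℝ))⁻¹ := by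
    rcases Nat.eq_zero_or_pos n with rfl | hn
    · simp
    · have : (0 : ℝ) < n := by exact_mod_cast hn
      have h2 := Real.mul_self_sqrt this.le
      field_simp
      nlinarith
  have hi : inner ℝ (√(n : ℝ) • sampleMean X ζ n w) t =
      (√(n : ℝ))⁻¹ * ∑ k ∈ Finset.range n, η (X k w) := by
    rw [sampleMean, smul_smul, hsq, inner_smul_left, sum_inner]
    simp [hη]
  rw [hi]
  simp only [hP0]
  simp

end LimitTheorems

/-! ### Zeros of nearly linear maps -/

section NearlyLinear

variable {E : Type*} [NormedAddCommGroup E] [NormedSpace ℝ E]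

/-- Comparison of a nearly linear map with the linear map `A` of which `B` is a left inverse. -/
theorem norm_sub_sub_apply_le {A B H : E →L[ℝ] E} (hBA : B ∘L A = .id ℝ E) {u v : E} {c : ℝ}
    (h : ‖v - H u‖ ≤ c * ‖u‖) : ‖u - B v‖ ≤ ‖B‖ * (‖H - A‖ + c) * ‖u‖ := by
  have hu : B (A u) = u := by simpa using congrArg (fun L : E →L[ℝ] E => L u) hBA
  have heq : u - B v = -B ((v - H u) + (H - A) u) := by
    simp only [_root_.sub_apply, map_add, map_sub, hu]
    abel
  calc ‖u - B v‖ = ‖B ((v - H u) + (H - A) u)‖ := by rw [heq, norm_neg]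
    _ ≤ ‖B‖ * ‖(v - H u) + (H - A) u‖ := B.le_opNorm _
    _ ≤ ‖B‖ * (c * ‖u‖ + ‖H - A‖ * ‖u‖) := by
        gcongr
        exact (norm_add_le _ _).trans (add_le_add h ((H - A).le_opNorm u))
    _ = ‖B‖ * (‖H - A‖ + c) * ‖u‖ := by ring

/-- If `F` is close to an invertible linear map `A` on a ball and small at its centre, then the
simplified Newton iteration `θ ↦ θ - A⁻¹ (F θ)` is a contraction of the ball, so that its iterates
converge to a zero of `F`. -/
theorem exists_zero_of_nearly_linear [CompleteSpace E] {F Φ : E → E} {A B H : E →L[ℝ] E}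
    {θ₀ : E} {r c : ℝ} (hr : 0 < r) (hBA : B ∘L A = .id ℝ E) (hAB : A ∘L B = .id ℝ E)
    (hF : ∀ θ ∈ Metric.closedBall θ₀ r, ∀ θ' ∈ Metric.closedBall θ₀ r,
      ‖F θ - F θ' - H (θ - θ')‖ ≤ c * ‖θ - θ'‖)
    (hsmall : ‖B‖ * (‖H - A‖ + c) ≤ 1 / 2) (hcentre : ‖B (F θ₀)‖ ≤ r / 2)
    (hΦ : ∀ θ ∈ Metric.closedBall θ₀ r, Φ θ = θ - B (F θ)) :
    ∃ θ ∈ Metric.closedBall θ₀ r, F θ = 0 ∧ ‖θ - θ₀‖ ≤ 2 * ‖B (F θ₀)‖ ∧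
      Tendsto (fun k => Φ^[k] θ₀) atTop (𝓝 θ) := by
  have h0 : θ₀ ∈ Metric.closedBall θ₀ r := Metric.mem_closedBall_self hr.le
  have hcontr : ∀ θ ∈ Metric.closedBall θ₀ r, ∀ θ' ∈ Metric.closedBall θ₀ r,
      ‖Φ θ - Φ θ'‖ ≤ 1 / 2 * ‖θ - θ'‖ := by
    intro θ hθ θ' hθ'
    have h := norm_sub_sub_apply_le hBA (hF θ hθ θ' hθ')
    have heq : Φ θ - Φ θ' = θ - θ' - B (F θ - F θ') := by
      rw [hΦ θ hθ, hΦ θ' hθ', map_sub]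
      abel
    rw [heq]
    exact h.trans (by gcongr)
  have hΦ0 : Φ θ₀ - θ₀ = -B (F θ₀) := by
    rw [hΦ θ₀ h0]
    abel
  have hmaps : Set.MapsTo Φ (Metric.closedBall θ₀ r) (Metric.closedBall θ₀ r) := by
    intro θ hθ
    have h1 := hcontr θ hθ θ₀ h0
    rw [mem_closedBall_iff_norm] at hθ ⊢
    calc ‖Φ θ - θ₀‖ = ‖(Φ θ - Φ θ₀) + (Φ θ₀ - θ₀)‖ := by congr 1; abel
      _ ≤ ‖Φ θ - Φ θ₀‖ + ‖B (F θ₀)‖ := by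
          refine (norm_add_le _ _).trans ?_
          rw [hΦ0, norm_neg]
      _ ≤ r := by linarith
  have hK : ContractingWith (1 / 2 : NNReal) (hmaps.restrict Φ _ _) := by
    refine ⟨by rw [← NNReal.coe_lt_coe]; norm_num, LipschitzWith.of_dist_le_mul fun a b => ?_⟩
    rw [Subtype.dist_eq, Subtype.dist_eq, dist_eq_norm, dist_eq_norm]
    simpa using hcontr a a.2 b b.2
  obtain ⟨θ, hθ, hfix, hlim, -⟩ := ContractingWith.exists_fixedPoint'
    (Metric.isClosed_closedBall.isComplete) hmaps hK h0 (edist_ne_top _ _)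
  have hfix' : Φ θ = θ := hfix
  have hB0 : B (F θ) = 0 := by
    have h := hΦ θ hθ
    rw [hfix'] at h
    exact sub_eq_self.1 h.symm
  refine ⟨θ, hθ, ?_, ?_, hlim⟩
  · have h := congrArg (fun L : E →L[ℝ] E => L (F θ)) hAB
    simpa [hB0] using h.symm
  · have h1 := hcontr θ hθ θ₀ h0
    have h2 : ‖θ - θ₀‖ ≤ ‖Φ θ - Φ θ₀‖ + ‖B (F θ₀)‖ := by
      calc ‖θ - θ₀‖ = ‖(Φ θ - Φ θ₀) + (Φ θ₀ - θ₀)‖ := by rw [hfix']; congr 1; abel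
        _ ≤ _ := by
          refine (norm_add_le _ _).trans ?_
          rw [hΦ0, norm_neg]
    linarith

/-- A continuous retraction of a normed space onto the closed ball of radius `r` around `c`. -/
noncomputable def ballRetraction (c : E) (r : ℝ) (θ : E) : E :=
  c + (r / max r ‖θ - c‖) • (θ - c)

theorem continuous_ballRetraction (c : E) {r : ℝ} (hr : 0 < r) :
    Continuous (ballRetraction c r) := by
  unfold ballRetraction
  have h : ∀ θ : E, max r ‖θ - c‖ ≠ 0 := fun θ => (lt_max_of_lt_left hr).ne'
  exact continuous_const.add ((continuous_const.div (by fun_prop) h).smul (by fun_prop))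

theorem ballRetraction_mem (c : E) {r : ℝ} (hr : 0 < r) (θ : E) :
    ballRetraction c r θ ∈ Metric.closedBall c r := by
  have h : 0 < max r ‖θ - c‖ := lt_max_of_lt_left hr
  rw [mem_closedBall_iff_norm, ballRetraction, add_sub_cancel_left, norm_smul, Real.norm_eq_abs,
    abs_of_pos (by positivity), div_mul_eq_mul_div, div_le_iff₀ h]
  gcongr
  exact le_max_right _ _

theorem ballRetraction_of_mem {c : E} {r : ℝ} (hr : 0 < r) {θ : E}
    (h : θ ∈ Metric.closedBall c r) : ballRetraction c r θ = θ := by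
  rw [mem_closedBall_iff_norm] at h
  simp [ballRetraction, max_eq_left h, hr.ne']

end NearlyLinear

/-! ### Consistency and asymptotic linearity of roots of estimating equations -/

section ZEstimator

variable {E : Type*} [NormedAddCommGroup E] [NormedSpace ℝ E] [MeasurableSpace E]
  {𝒳 : Type*} [MeasurableSpace 𝒳]

/-- Regularity of an estimating function `Ψ x θ` near the parameter `θ₀` for observations with law
`ν`. On a measurable set `S` of full measure, `Ψ x` is linear with derivative `H x` up to an error
controlled by the integrable function `M`, uniformly on balls around `θ₀`; this is what a bound on
the second derivatives of `Ψ x` amounts to. The expectation of `Ψ x θ₀` vanishes, and `H x` has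
expectation `A`. -/
structure RegularEstimatingFunction (ν : Measure 𝒳) (Ψ : 𝒳 → E → E) (θ₀ : E) (r : ℝ)
    (S : Set 𝒳) (H : 𝒳 → E →L[ℝ] E) (A : E →L[ℝ] E) (M : 𝒳 → ℝ) : Prop where
  radius_pos : 0 < r
  measurableSet : MeasurableSet S
  ae_mem : ∀ᵐ x ∂ν, x ∈ S
  measurable_indicator : ∀ θ ∈ Metric.closedBall θ₀ r, Measurable (S.indicator fun x => Ψ x θ)
  bound : ∀ x ∈ S, ∀ ρ ≤ r, ∀ θ ∈ Metric.closedBall θ₀ ρ, ∀ θ' ∈ Metric.closedBall θ₀ ρ,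
    ‖Ψ x θ - Ψ x θ' - H x (θ - θ')‖ ≤ M x * ρ * ‖θ - θ'‖
  integrable : Integrable (fun x => Ψ x θ₀) ν
  integral_eq_zero : ∫ x, Ψ x θ₀ ∂ν = 0
  integrable_deriv : Integrable H ν
  integral_deriv : ∫ x, H x ∂ν = A
  integrable_bound : Integrable M ν

namespace RegularEstimatingFunction

variable {ν : Measure 𝒳} {Ψ : 𝒳 → E → E} {θ₀ : E} {r : ℝ} {S : Set 𝒳} {H : 𝒳 → E →L[ℝ] E}
  {A B : E →L[ℝ] E} {M : 𝒳 → ℝ}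

theorem shrink (h : RegularEstimatingFunction ν Ψ θ₀ r S H A M) {r' : ℝ} (hr' : 0 < r')
    (hle : r' ≤ r) : RegularEstimatingFunction ν Ψ θ₀ r' S H A M :=
  { h with
    radius_pos := hr'
    measurable_indicator := fun θ hθ =>
      h.measurable_indicator θ (Metric.closedBall_subset_closedBall hle hθ)
    bound := fun x hx ρ hρ => h.bound x hx ρ (hρ.trans hle) }

theorem continuousOn (h : RegularEstimatingFunction ν Ψ θ₀ r S H A M) {x : 𝒳} (hx : x ∈ S) :
    ContinuousOn (Ψ x) (Metric.closedBall θ₀ r) := by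
  refine (LipschitzOnWith.of_dist_le_mul (K := (‖H x‖ + |M x| * r).toNNReal)
    fun θ hθ θ' hθ' => ?_).continuousOn
  have hr := h.radius_pos.le
  rw [dist_eq_norm, dist_eq_norm, Real.coe_toNNReal _ (by positivity)]
  calc ‖Ψ x θ - Ψ x θ'‖ = ‖(Ψ x θ - Ψ x θ' - H x (θ - θ')) + H x (θ - θ')‖ := by
        rw [sub_add_cancel]
    _ ≤ |M x| * r * ‖θ - θ'‖ + ‖H x‖ * ‖θ - θ'‖ := by
        refine (norm_add_le _ _).trans (add_le_add ?_ ((H x).le_opNorm _))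
        exact (h.bound x hx r le_rfl θ hθ θ' hθ').trans (by gcongr; exact le_abs_self _)
    _ = (‖H x‖ + |M x| * r) * ‖θ - θ'‖ := by ring

variable {Ω : Type*} {X : ℕ → Ω → 𝒳}

theorem sampleMean_bound (h : RegularEstimatingFunction ν Ψ θ₀ r S H A M) {n : ℕ} {w : Ω}
    (hw : ∀ i, X i w ∈ S) {ρ : ℝ} (hρ : ρ ≤ r) {θ θ' : E} (hθ : θ ∈ Metric.closedBall θ₀ ρ)
    (hθ' : θ' ∈ Metric.closedBall θ₀ ρ) :
    ‖sampleMean X (fun x => Ψ x θ) n w - sampleMean X (fun x => Ψ x θ') n w -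
      sampleMean X H n w (θ - θ')‖ ≤ sampleMean X M n w * ρ * ‖θ - θ'‖ := by
  simp only [sampleMean, _root_.smul_apply, _root_.sum_apply]
  rw [← smul_sub, ← smul_sub, ← Finset.sum_sub_distrib, ← Finset.sum_sub_distrib, norm_smul,
    Real.norm_eq_abs, abs_of_nonneg (by positivity), smul_eq_mul, mul_assoc, mul_assoc]
  gcongr
  rw [Finset.sum_mul]
  refine (norm_sum_le _ _).trans (Finset.sum_le_sum fun i _ => ?_)
  rw [← mul_assoc]
  exact h.bound _ (hw i) ρ hρ θ hθ θ' hθ'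

variable [MeasurableSpace Ω] {P : Measure Ω}

theorem ae_forall_mem (h : RegularEstimatingFunction ν Ψ θ₀ r S H A M)
    (hlaw : ∀ i, HasLaw (X i) ν P) : ∀ᵐ w ∂P, ∀ i, X i w ∈ S :=
  ae_all_iff.2 fun i => ((hlaw i).ae_iff (p := fun x => x ∈ S)
    (measurableSet_setOfPred.1 h.measurableSet)).2 h.ae_mem

/-- A version of the estimating function which is everywhere continuous in the parameter and
measurable in the observation: `Ψ` is set to zero off `S` and extended from the ball by a
retraction. -/
noncomputable def extension (Ψ : 𝒳 → E → E) (θ₀ : E) (r : ℝ) (S : Set 𝒳) (θ : E) (x : 𝒳) : E :=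
  S.indicator (fun x => Ψ x (ballRetraction θ₀ r θ)) x

variable [FiniteDimensional ℝ E] [BorelSpace E]

theorem measurable_uncurry_extension (h : RegularEstimatingFunction ν Ψ θ₀ r S H A M) :
    Measurable (Function.uncurry (extension Ψ θ₀ r S)) := by
  refine measurable_uncurry_of_continuous_of_measurable (fun x => ?_) fun θ => ?_
  · by_cases hx : x ∈ S
    · simp only [extension, Set.indicator_of_mem hx]
      exact (h.continuousOn hx).comp_continuous (continuous_ballRetraction θ₀ h.radius_pos)
        (ballRetraction_mem θ₀ h.radius_pos)
    · simp only [extension, Set.indicator_of_notMem hx]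
      exact continuous_const
  · exact h.measurable_indicator _ (ballRetraction_mem θ₀ h.radius_pos θ)

/-- One step `θ ↦ θ - B (n⁻¹ ∑_{i < n} Ψ(x_i, θ))` of the simplified Newton iteration for the
sample `x`. -/
noncomputable def newtonStep (Ψ : 𝒳 → E → E) (θ₀ : E) (r : ℝ) (S : Set 𝒳) (B : E →L[ℝ] E) {n : ℕ}
    (x : Fin n → 𝒳) (θ : E) : E :=
  θ - B ((n : ℝ)⁻¹ • ∑ i, extension Ψ θ₀ r S θ (x i))

/-- The limit of the simplified Newton iteration started at `θ₀`. -/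
noncomputable def newtonLimit (Ψ : 𝒳 → E → E) (θ₀ : E) (r : ℝ) (S : Set 𝒳) (B : E →L[ℝ] E)
    (n : ℕ) (x : Fin n → 𝒳) : E :=
  limUnder atTop fun k => (newtonStep Ψ θ₀ r S B x)^[k] θ₀

theorem measurable_newtonLimit (h : RegularEstimatingFunction ν Ψ θ₀ r S H A M) (B : E →L[ℝ] E)
    (n : ℕ) : Measurable (newtonLimit Ψ θ₀ r S B n) := by
  have hk : ∀ k, Measurable fun x : Fin n → 𝒳 => (newtonStep Ψ θ₀ r S B x)^[k] θ₀ := by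
    intro k
    induction k with
    | zero => exact measurable_const
    | succ k ih =>
      simp only [Function.iterate_succ_apply', newtonStep]
      refine ih.sub (B.measurable.comp ?_)
      refine Measurable.fun_const_smul (Finset.measurable_fun_sum _ fun i _ => ?_) _
      exact h.measurable_uncurry_extension.comp (ih.prodMk (measurable_pi_apply i))
  exact (StronglyMeasurable.limUnder fun k => (hk k).stronglyMeasurable).measurable

variable [IsProbabilityMeasure P]

/-- For a regular estimating function with invertible expected derivative there are measurable
functions of the sample which converge to `θ₀` in probability and are roots of the estimating
equation in a given neighbourhood of `θ₀`, with probability tending to one. -/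
theorem exists_consistent_roots (h : RegularEstimatingFunction ν Ψ θ₀ r S H A M)
    (hBA : B ∘L A = .id ℝ E) (hAB : A ∘L B = .id ℝ E) (hindep : iIndepFun X P)
    (hlaw : ∀ i, HasLaw (X i) ν P) :
    ∃ t : (n : ℕ) → (Fin n → 𝒳) → E, (∀ n, Measurable (t n)) ∧
      (WithHighProb P fun n w => t n (fun i => X i w) ∈ Metric.closedBall θ₀ r ∧
        ∑ i ∈ Finset.range n, Ψ (X i w) (t n fun i => X i w) = 0) ∧
      TendstoInMeasure P (fun n w => t n fun i => X i w) atTop fun _ => θ₀ := by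
  set m := ∫ x, M x ∂ν with hm
  set b := ‖B‖ + 1 with hb
  have hb0 : 0 < b := by positivity
  have hBb : ‖B‖ ≤ b := by simp [hb]
  -- on the ball of radius `r'` the error of linearization is a small multiple of the distance
  obtain ⟨r', hr', hle, hr'm⟩ : ∃ r' : ℝ, 0 < r' ∧ r' ≤ r ∧ (|m| + 1) * r' ≤ 1 / (4 * b) := by
    refine ⟨min r (1 / (4 * b) / (|m| + 1)), lt_min h.radius_pos (by positivity), min_le_left _ _,
      ?_⟩
    rw [mul_comm, ← le_div_iff₀ (by positivity)]
    exact min_le_right _ _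
  have h' := h.shrink hr' hle
  have hΨ := tendstoInMeasure_sampleMean hindep hlaw h.integrable
  have hH := tendstoInMeasure_sampleMean hindep hlaw h.integrable_deriv
  have hM := tendstoInMeasure_sampleMean hindep hlaw h.integrable_bound
  rw [h.integral_eq_zero] at hΨ
  rw [h.integral_deriv] at hH
  have key : ∀ ε > 0, ε ≤ r' → WithHighProb P fun n w =>
      ∑ i ∈ Finset.range n, Ψ (X i w) (newtonLimit Ψ θ₀ r' S B n fun i => X i w) = 0 ∧
      newtonLimit Ψ θ₀ r' S B n (fun i => X i w) ∈ Metric.closedBall θ₀ r' ∧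
      ‖newtonLimit Ψ θ₀ r' S B n (fun i => X i w) - θ₀‖ < ε := by
    intro ε hε hεr
    have hc1 : 0 < ε / (2 * b) := by positivity
    have hc2 : (0 : ℝ) < 1 / (4 * b) := by positivity
    have hgood := (((TendstoInMeasure.withHighProb hΨ hc1).and
      (TendstoInMeasure.withHighProb hH hc2)).and
      (TendstoInMeasure.withHighProb hM one_pos)).and
      ((WithHighProb.of_ae ((h.ae_forall_mem hlaw).mono fun w hw _ => hw)).and
        (WithHighProb.eventually (P := P) (A := fun n _ => 0 < n)
          ((eventually_gt_atTop 0).mono fun n hn _ => hn)))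
    refine hgood.mono fun n w hw => ?_
    obtain ⟨⟨⟨hw1, hw2⟩, hw3⟩, hwS, hn⟩ := hw
    rw [sub_zero] at hw1
    have hn' : (n : ℝ)⁻¹ ≠ 0 := inv_ne_zero (by exact_mod_cast hn.ne')
    have hMle : sampleMean X M n w * r' ≤ 1 / (4 * b) := by
      refine le_trans ?_ hr'm
      have h1 := (abs_lt.1 (by simpa using hw3)).2
      gcongr
      linarith [le_abs_self m]
    have hB1 : ‖B (sampleMean X (fun x => Ψ x θ₀) n w)‖ < ε / 2 := by
      calc _ ≤ ‖B‖ * ‖sampleMean X (fun x => Ψ x θ₀) n w‖ := B.le_opNorm _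
        _ ≤ b * ‖sampleMean X (fun x => Ψ x θ₀) n w‖ := by gcongr
        _ < b * (ε / (2 * b)) := by gcongr
        _ = ε / 2 := by field_simp
    obtain ⟨θ, hθ, hroot, hdist, hlim⟩ := exists_zero_of_nearly_linear
      (F := fun θ => sampleMean X (fun x => Ψ x θ) n w)
      (Φ := newtonStep Ψ θ₀ r' S B fun i : Fin n => X i w) (H := sampleMean X H n w)
      (c := sampleMean X M n w * r') hr' hBA hAB
      (fun θ hθ θ' hθ' => h'.sampleMean_bound hwS le_rfl hθ hθ')
      (by
        calc _ ≤ ‖B‖ * (1 / (4 * b) + 1 / (4 * b)) := by gcongr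
          _ ≤ b * (1 / (4 * b) + 1 / (4 * b)) := by gcongr
          _ = 1 / 2 := by field_simp; norm_num)
      (by linarith)
      (fun θ hθ => by
        simp only [newtonStep, extension, ballRetraction_of_mem hr' hθ,
          Set.indicator_of_mem (hwS _), sampleMean]
        rw [Finset.sum_range fun i => Ψ (X i w) θ])
    have hlim' : newtonLimit Ψ θ₀ r' S B n (fun i => X i w) = θ := hlim.limUnder_eq
    rw [hlim']
    refine ⟨?_, hθ, by linarith⟩
    simpa [sampleMean, hn.ne'] using hroot
  refine ⟨newtonLimit Ψ θ₀ r' S B, h'.measurable_newtonLimit B, ?_, ?_⟩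
  · exact (key r' hr' le_rfl).mono fun n w hw =>
      ⟨Metric.closedBall_subset_closedBall hle hw.2.1, hw.1⟩
  · refine tendstoInMeasure_iff_withHighProb.2 fun ε hε => ?_
    exact (key (min ε r') (lt_min hε hr') (min_le_right _ _)).mono fun n w hw =>
      hw.2.2.trans_le (min_le_left _ _)

/-- For a consistent sequence of roots `θ̂_n`, the difference of `√n (θ̂_n - θ₀)` and the normalized
sum `√n (n⁻¹ ∑_{i < n} -A⁻¹ Ψ(X_i, θ₀))` tends to zero in probability, so that the two have the same
limit in distribution. -/
theorem tendstoInDistribution_of_roots (h : RegularEstimatingFunction ν Ψ θ₀ r S H A M)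
    (hBA : B ∘L A = .id ℝ E) (hindep : iIndepFun X P)
    (hlaw : ∀ i, HasLaw (X i) ν P) {Ω' : Type*} [MeasurableSpace Ω'] {P' : Measure Ω'}
    [IsProbabilityMeasure P'] {Z : Ω' → E}
    (hZ : TendstoInDistribution
      (fun (n : ℕ) w => √(n : ℝ) • sampleMean X (fun x => -B (Ψ x θ₀)) n w) atTop Z
      (fun _ => P) P')
    {θhat : ℕ → Ω → E} (hmeas : ∀ n, AEMeasurable (θhat n) P)
    (hroot : WithHighProb P fun n w => ∑ i ∈ Finset.range n, Ψ (X i w) (θhat n w) = 0)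
    (hcons : TendstoInMeasure P θhat atTop fun _ => θ₀) :
    TendstoInDistribution (fun (n : ℕ) w => √(n : ℝ) • (θhat n w - θ₀)) atTop Z
      (fun _ => P) P' := by
  set Zn : ℕ → Ω → E := fun n w => √(n : ℝ) • sampleMean X (fun x => -B (Ψ x θ₀)) n w with hZn
  have hH := tendstoInMeasure_sampleMean hindep hlaw h.integrable_deriv
  have hM := tendstoInMeasure_sampleMean hindep hlaw h.integrable_bound
  rw [h.integral_deriv] at hH
  set m := ∫ x, M x ∂ν with hm
  -- the relative error of the linearization at `θhat n`
  set R : ℕ → Ω → ℝ := fun n w =>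
    ‖B‖ * (‖sampleMean X H n w - A‖ + sampleMean X M n w * ‖θhat n w - θ₀‖) with hR
  have hRm : ∀ n, AEMeasurable (R n) P := by
    intro n
    have h1 := aemeasurable_sampleMean hlaw h.integrable_deriv.aestronglyMeasurable.aemeasurable n
    have h2 := aemeasurable_sampleMean hlaw h.integrable_bound.aestronglyMeasurable.aemeasurable n
    have h3 := hmeas n
    exact ((h1.sub_const A).norm.add (h2.mul (h3.sub_const θ₀).norm)).const_mul _
  have hR0 : TendstoInMeasure P R atTop fun _ => 0 := by
    refine tendstoInMeasure_iff_withHighProb.2 fun ε hε => ?_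
    have hc1 : 0 < ε / (2 * (‖B‖ + 1)) := by positivity
    have hc2 : 0 < ε / (2 * (‖B‖ + 1)) / (|m| + 1) := by positivity
    refine (((TendstoInMeasure.withHighProb hH hc1).and
      (TendstoInMeasure.withHighProb hcons hc2)).and
      (TendstoInMeasure.withHighProb hM one_pos)).mono fun n w hw => ?_
    obtain ⟨⟨hw1, hw2⟩, hw3⟩ := hw
    have hMle : |sampleMean X M n w| ≤ |m| + 1 := by
      have h1 : |sampleMean X M n w - m| < 1 := by simpa using hw3
      have h2 := abs_sub_abs_le_abs_sub (sampleMean X M n w) m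
      linarith
    rw [sub_zero, Real.norm_eq_abs, hR]
    simp only [abs_mul, abs_norm]
    calc ‖B‖ * |‖sampleMean X H n w - A‖ + sampleMean X M n w * ‖θhat n w - θ₀‖|
        ≤ ‖B‖ * (‖sampleMean X H n w - A‖ + |sampleMean X M n w| * ‖θhat n w - θ₀‖) := by
          gcongr
          refine (abs_add_le _ _).trans ?_
          rw [abs_norm, abs_mul, abs_norm]
      _ ≤ ‖B‖ * (ε / (2 * (‖B‖ + 1)) + (|m| + 1) * (ε / (2 * (‖B‖ + 1)) / (|m| + 1))) := by
          gcongr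
      _ = ‖B‖ / (‖B‖ + 1) * ε := by field_simp; norm_num
      _ < 1 * ε := by
          gcongr
          rw [div_lt_one (by positivity)]
          linarith
      _ = ε := one_mul ε
  -- by Slutsky's theorem the error is negligible with respect to the tight sequence `Zn`
  have hRZ : TendstoInMeasure P (fun n w => 2 * R n w * ‖Zn n w‖) atTop fun _ => 0 := by
    refine TendstoInDistribution.tendstoInMeasure_zero (P' := P') ?_
    have h1 := hZ.continuous_comp_prodMk_of_tendstoInMeasure_const
      (g := fun q : E × ℝ => 2 * q.2 * ‖q.1‖) (by fun_prop) hR0 hRm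
    simpa using h1
  refine tendstoInDistribution_of_tendstoInMeasure_sub _ Z hZ ?_ fun n =>
    ((hmeas n).sub_const θ₀).fun_const_smul _
  refine tendstoInMeasure_iff_withHighProb.2 fun ε hε => ?_
  refine ((((TendstoInMeasure.withHighProb hRZ hε).and
    (TendstoInMeasure.withHighProb hR0 (half_pos one_pos))).and
    (TendstoInMeasure.withHighProb hcons h.radius_pos)).and
    (hroot.and (WithHighProb.of_ae ((h.ae_forall_mem hlaw).mono fun w hw _ => hw)))).mono
    fun n w hw => ?_
  obtain ⟨⟨⟨hw1, hw2⟩, hw3⟩, hw4, hwS⟩ := hw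
  set δ := θhat n w - θ₀ with hδ
  have hmean0 : sampleMean X (fun x => Ψ x (θhat n w)) n w = 0 := by
    rw [sampleMean, hw4, smul_zero]
  have hlin := h.sampleMean_bound (n := n) hwS (ρ := ‖δ‖) hw3.le (θ := θ₀) (θ' := θhat n w)
    (Metric.mem_closedBall_self (norm_nonneg _)) (by rw [mem_closedBall_iff_norm])
  rw [hmean0, sub_zero, norm_sub_rev θ₀] at hlin
  have hlin' : ‖-sampleMean X (fun x => Ψ x θ₀) n w - sampleMean X H n w δ‖ ≤
      sampleMean X M n w * ‖δ‖ * ‖δ‖ := by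
    refine le_trans (le_of_eq ?_) hlin
    rw [← norm_neg, ← neg_sub (θhat n w) θ₀, map_neg]
    congr 1
    abel
  have hmain : ‖δ - B (-sampleMean X (fun x => Ψ x θ₀) n w)‖ ≤ R n w * ‖δ‖ :=
    norm_sub_sub_apply_le hBA hlin'
  set y := B (-sampleMean X (fun x => Ψ x θ₀) n w) with hy
  have hyZ : Zn n w = √(n : ℝ) • y := by
    simp [hZn, hy, sampleMean, map_sum]
  have hR2 : R n w ≤ 1 / 2 := by
    have := (abs_lt.1 (by simpa using hw2)).2
    linarith
  have hδy : ‖δ‖ ≤ 2 * ‖y‖ := by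
    have h1 : ‖δ‖ ≤ ‖δ - y‖ + ‖y‖ := by simpa using norm_add_le (δ - y) y
    have h2 : R n w * ‖δ‖ ≤ 1 / 2 * ‖δ‖ := by gcongr
    linarith
  have hfin : ‖√(n : ℝ) • δ - Zn n w‖ ≤ |2 * R n w * ‖Zn n w‖| := by
    rw [hyZ, ← smul_sub, norm_smul, norm_smul, Real.norm_eq_abs, abs_of_nonneg (Real.sqrt_nonneg _),
      abs_mul, abs_mul, abs_two, abs_of_nonneg (by positivity : 0 ≤ √(n : ℝ) * ‖y‖)]
    have hle : ‖δ - y‖ ≤ 2 * |R n w| * ‖y‖ := by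
      calc ‖δ - y‖ ≤ R n w * ‖δ‖ := hmain
        _ ≤ |R n w| * ‖δ‖ := by gcongr; exact le_abs_self _
        _ ≤ |R n w| * (2 * ‖y‖) := by gcongr
        _ = 2 * |R n w| * ‖y‖ := by ring
    calc √(n : ℝ) * ‖δ - y‖ ≤ √(n : ℝ) * (2 * |R n w| * ‖y‖) := by gcongr
      _ = 2 * |R n w| * (√(n : ℝ) * ‖y‖) := by ring
  rw [sub_zero, Real.norm_eq_abs] at hw1
  simpa using lt_of_le_of_lt hfin hw1

end RegularEstimatingFunction

end ZEstimator

/-! ### Calculus of the generating function -/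

section GeneratingFunction

variable (α β γ : ℝ) {y : ℝ}

theorem hasDerivAt_epdB' (hy : 0 < y) :
    HasDerivAt (epdB' α β γ) (epdWeight α β γ y / y) y := by
  have h1 : HasDerivAt (fun z : ℝ => if α = 0 then z else (Real.exp (α * z) - 1) / α)
      (Real.exp (α * y)) y := by
    split_ifs with h
    · simpa [h] using hasDerivAt_id' y
    · have h2 : HasDerivAt (fun z : ℝ => α * z) α y := by
        simpa using (hasDerivAt_id y).const_mul α
      have h3 := (h2.exp.sub_const 1).div_const α
      rwa [mul_div_cancel_right₀ _ h] at h3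
  have h2 : HasDerivAt
      (fun z : ℝ => if γ = 0 then Real.log z + 1 else ((γ + 1) * z ^ γ - 1) / γ)
      ((γ + 1) * y ^ γ / y) y := by
    split_ifs with h
    · simpa [h] using (Real.hasDerivAt_log hy.ne').add_const 1
    · have h3 := (((Real.hasDerivAt_rpow_const (p := γ) (Or.inl hy.ne')).const_mul
        (γ + 1)).sub_const 1).div_const γ
      refine h3.congr_deriv ?_
      rw [Real.rpow_sub_one hy.ne']
      field_simp
  have h3 := (h1.const_mul β).add (h2.const_mul (1 - β))
  have heq : epdWeight α β γ y / y =
      β * Real.exp (α * y) + (1 - β) * ((γ + 1) * y ^ γ / y) := by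
    unfold epdWeight
    field_simp
  rw [heq]
  exact h3

/-- The derivative `w'(y)` of the weight, written with denominator `y`. -/
theorem hasDerivAt_epdWeight (hy : 0 < y) :
    HasDerivAt (epdWeight α β γ) ((β * y * Real.exp (α * y) + α * β * y ^ 2 * Real.exp (α * y) +
      (1 - β) * (γ + 1) * γ * y ^ γ) / y) y := by
  have h1 : HasDerivAt (fun z : ℝ => α * z) α y := by simpa using (hasDerivAt_id y).const_mul α
  have h2 := ((((hasDerivAt_id y).const_mul β).mul h1.exp)).add
    ((Real.hasDerivAt_rpow_const (p := γ) (Or.inl hy.ne')).const_mul ((1 - β) * (γ + 1)))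
  refine h2.congr_deriv ?_
  rw [Real.rpow_sub_one hy.ne']
  simp only [id]
  field_simp

theorem contDiffAt_epdB' {n : ℕ} (hy : 0 < y) : ContDiffAt ℝ n (epdB' α β γ) y := by
  have hid : ContDiffAt ℝ n (fun z : ℝ => z) y := contDiffAt_id
  unfold epdB'
  refine (contDiffAt_const.mul ?_).add (contDiffAt_const.mul ?_)
  · split_ifs with h
    · exact hid
    · exact ((contDiffAt_const.mul hid).exp.sub contDiffAt_const).div_const α
  · split_ifs with h
    · exact (hid.log hy.ne').add contDiffAt_const
    · exact ((contDiffAt_const.mul (Real.contDiffAt_rpow_const (Or.inl hy.ne'))).sub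
        contDiffAt_const).div_const γ

theorem contDiffAt_epdB {n : ℕ} (hy : 0 < y) : ContDiffAt ℝ n (epdB α β γ) y := by
  have hid : ContDiffAt ℝ n (fun z : ℝ => z) y := contDiffAt_id
  unfold epdB
  refine (contDiffAt_const.mul ?_).add (contDiffAt_const.mul ?_)
  · split_ifs with h
    · exact (hid.pow 2).div_const 2
    · exact (((contDiffAt_const.mul hid).exp.sub contDiffAt_const).sub
        (contDiffAt_const.mul hid)).div_const _
  · split_ifs with h
    · exact hid.mul (hid.log hy.ne')
    · exact ((Real.contDiffAt_rpow_const (Or.inl hy.ne')).sub hid).div_const γ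

theorem measurable_epdB' : Measurable (epdB' α β γ) := by
  unfold epdB'
  split_ifs <;> fun_prop

end GeneratingFunction

/-! ### Pointwise derivatives of the model -/

section Model

variable {p : ℕ} {𝒳 : Type*}

/-- At the observation `x` the densities `f θ`, `θ ∈ ω`, depend smoothly on the parameter and are
either all positive or all zero. -/
structure IsSmoothModelAt (f : EuclideanSpace ℝ (Fin p) → 𝒳 → ℝ)
    (ω : Set (EuclideanSpace ℝ (Fin p))) (x : 𝒳) : Prop where
  contDiffOn : ContDiffOn ℝ 3 (fun θ => f θ x) ω
  pos_or_zero : (∀ θ ∈ ω, 0 < f θ x) ∨ ∀ θ ∈ ω, f θ x = 0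

namespace IsSmoothModelAt

variable {f : EuclideanSpace ℝ (Fin p) → 𝒳 → ℝ} {ω : Set (EuclideanSpace ℝ (Fin p))} {x : 𝒳}
  {θ : EuclideanSpace ℝ (Fin p)} (α β γ : ℝ)

theorem contDiffAt (h : IsSmoothModelAt f ω x) (hω : IsOpen ω) (hθ : θ ∈ ω) :
    ContDiffAt ℝ 3 (fun t => f t x) θ :=
  h.contDiffOn.contDiffAt (hω.mem_nhds hθ)

theorem hasFDerivAt (h : IsSmoothModelAt f ω x) (hω : IsOpen ω) (hθ : θ ∈ ω) :
    HasFDerivAt (fun t => f t x) (fderiv ℝ (fun t => f t x) θ) θ :=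
  ((h.contDiffAt hω hθ).differentiableAt (by norm_num)).hasFDerivAt

/-- A function of the density is, near a parameter of `ω`, smooth if it is smooth on `(0, ∞)`: in
the other case the density vanishes on `ω`. -/
theorem contDiffAt_comp (h : IsSmoothModelAt f ω x) (hω : IsOpen ω) (hθ : θ ∈ ω) {q : ℝ → ℝ}
    (hq : ∀ y, 0 < y → ContDiffAt ℝ 3 q y) : ContDiffAt ℝ 3 (fun t => q (f t x)) θ := by
  rcases h.pos_or_zero with hpos | hzero
  · exact (hq _ (hpos θ hθ)).comp θ (h.contDiffAt hω hθ)
  · refine (contDiffAt_const (c := q 0)).congr_of_eventuallyEq ?_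
    filter_upwards [hω.mem_nhds hθ] with t ht
    rw [hzero t ht]

theorem contDiffAt_epdB' (h : IsSmoothModelAt f ω x) (hω : IsOpen ω) (hθ : θ ∈ ω) :
    ContDiffAt ℝ 3 (fun t => epdB' α β γ (f t x)) θ :=
  h.contDiffAt_comp hω hθ fun _ hy => _root_.contDiffAt_epdB' α β γ (n := 3) hy

theorem contDiffAt_integrand (h : IsSmoothModelAt f ω x) (hω : IsOpen ω) (hθ : θ ∈ ω) :
    ContDiffAt ℝ 3 (fun t => epdB' α β γ (f t x) * f t x - epdB α β γ (f t x)) θ :=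
  ((h.contDiffAt_epdB' α β γ hω hθ).mul (h.contDiffAt hω hθ)).sub
    (h.contDiffAt_comp hω hθ fun _ hy => _root_.contDiffAt_epdB α β γ (n := 3) hy)

theorem fderiv_density (h : IsSmoothModelAt f ω x) (hω : IsOpen ω) (hθ : θ ∈ ω)
    (v : EuclideanSpace ℝ (Fin p)) :
    fderiv ℝ (fun t => f t x) θ v = f θ x * inner ℝ (score f θ x) v := by
  rw [score, inner_gradient_left]
  rcases h.pos_or_zero with hpos | hzero
  · rw [((h.hasFDerivAt hω hθ).log (hpos θ hθ).ne').fderiv]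
    simp [(hpos θ hθ).ne']
  · have h0 : (fun t => f t x) =ᶠ[𝓝 θ] fun _ => 0 := by
      filter_upwards [hω.mem_nhds hθ] with t ht using hzero t ht
    rw [h0.fderiv_eq, hzero θ hθ]
    simp

theorem score_eq_zero (hzero : ∀ θ ∈ ω, f θ x = 0) (hω : IsOpen ω) (hθ : θ ∈ ω) :
    score f θ x = 0 := by
  have h0 : (fun t => Real.log (f t x)) =ᶠ[𝓝 θ] fun _ => 0 := by
    filter_upwards [hω.mem_nhds hθ] with t ht
    rw [hzero t ht, Real.log_zero]
  rw [score, gradient, h0.fderiv_eq]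
  simp

/-- The function `T_θ(x)` is the gradient of `B'(f_θ(x))`. -/
theorem fderiv_epdB' (h : IsSmoothModelAt f ω x) (hω : IsOpen ω) (hθ : θ ∈ ω)
    (v : EuclideanSpace ℝ (Fin p)) :
    fderiv ℝ (fun t => epdB' α β γ (f t x)) θ v = inner ℝ (epdT α β γ f θ x) v := by
  rw [epdT, inner_smul_left]
  rcases h.pos_or_zero with hpos | hzero
  · have hc := (hasDerivAt_epdB' α β γ (hpos θ hθ)).comp_hasFDerivAt θ (h.hasFDerivAt hω hθ)
    have hc' : fderiv ℝ (fun t => epdB' α β γ (f t x)) θ = _ := hc.fderiv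
    rw [hc', _root_.smul_apply, h.fderiv_density hω hθ, smul_eq_mul]
    have := (hpos θ hθ).ne'
    simp
    field_simp
  · have h0 : (fun t => epdB' α β γ (f t x)) =ᶠ[𝓝 θ] fun _ => epdB' α β γ 0 := by
      filter_upwards [hω.mem_nhds hθ] with t ht
      rw [hzero t ht]
    rw [h0.fderiv_eq, score_eq_zero hzero hω hθ]
    simp

/-- The function `f_θ(x) T_θ(x)` is the gradient of `B'(f_θ(x)) f_θ(x) - B(f_θ(x))`. -/
theorem fderiv_integrand (h : IsSmoothModelAt f ω x) (hω : IsOpen ω) (hθ : θ ∈ ω)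
    (v : EuclideanSpace ℝ (Fin p)) :
    fderiv ℝ (fun t => epdB' α β γ (f t x) * f t x - epdB α β γ (f t x)) θ v =
      f θ x * inner ℝ (epdT α β γ f θ x) v := by
  rcases h.pos_or_zero with hpos | hzero
  · have h1 := ((h.contDiffAt_epdB' α β γ hω hθ).differentiableAt (by norm_num)).hasFDerivAt
    have h2 := (hasDerivAt_epdB α β γ (hpos θ hθ)).comp_hasFDerivAt θ (h.hasFDerivAt hω hθ)
    have h3 := (h1.mul (h.hasFDerivAt hω hθ)).sub h2
    have h4 : fderiv ℝ (fun t => epdB' α β γ (f t x) * f t x - epdB α β γ (f t x)) θ = _ :=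
      h3.fderiv
    rw [h4, ← h.fderiv_epdB' α β γ hω hθ]
    simp
  · have h0 : (fun t => epdB' α β γ (f t x) * f t x - epdB α β γ (f t x)) =ᶠ[𝓝 θ]
        fun _ => epdB' α β γ 0 * 0 - epdB α β γ 0 := by
      filter_upwards [hω.mem_nhds hθ] with t ht
      rw [hzero t ht]
    rw [h0.fderiv_eq, hzero θ hθ]
    simp

end IsSmoothModelAt

theorem inner_stdVec (v : EuclideanSpace ℝ (Fin p)) (k : Fin p) : inner ℝ v (stdVec k) = v k := by
  rw [stdVec, EuclideanSpace.inner_single_right]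
  simp

/-- The second derivative as a directional derivative of a directional derivative. -/
theorem iteratedFDeriv_two_apply_of_contDiffAt {F : EuclideanSpace ℝ (Fin p) → ℝ}
    {θ : EuclideanSpace ℝ (Fin p)} (hF : ContDiffAt ℝ 2 F θ) (u v : EuclideanSpace ℝ (Fin p)) :
    iteratedFDeriv ℝ 2 F θ ![u, v] = fderiv ℝ (fun t => fderiv ℝ F t v) θ u := by
  have h1 : DifferentiableAt ℝ (fderiv ℝ F) θ :=
    (hF.fderiv_right (m := 1) (by norm_num)).differentiableAt (by norm_num)
  have h2 := h1.hasFDerivAt.clm_apply (hasFDerivAt_const v θ)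
  rw [iteratedFDeriv_two_apply, h2.fderiv]
  simp

namespace IsSmoothModelAt

variable {f : EuclideanSpace ℝ (Fin p) → 𝒳 → ℝ} {ω : Set (EuclideanSpace ℝ (Fin p))} {x : 𝒳}
  {θ : EuclideanSpace ℝ (Fin p)} (α β γ : ℝ)

/-- The derivative of `T_θ(x)` in terms of the score and the information function. -/
theorem iteratedFDeriv_epdB' (h : IsSmoothModelAt f ω x) (hω : IsOpen ω) (hθ : θ ∈ ω)
    (hpos : ∀ θ ∈ ω, 0 < f θ x) (k l : Fin p) :
    iteratedFDeriv ℝ 2 (fun t => epdB' α β γ (f t x)) θ ![stdVec l, stdVec k] =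
      (β * f θ x * Real.exp (α * f θ x) + α * β * f θ x ^ 2 * Real.exp (α * f θ x) +
        (1 - β) * (γ + 1) * γ * f θ x ^ γ) * (score f θ x k * score f θ x l) -
      epdWeight α β γ (f θ x) * infoMatrix f θ x k l := by
  rw [iteratedFDeriv_two_apply_of_contDiffAt ((h.contDiffAt_epdB' α β γ hω hθ).of_le (by norm_num))]
  have heq : (fun t => fderiv ℝ (fun t => epdB' α β γ (f t x)) t (stdVec k)) =ᶠ[𝓝 θ]
      fun t => epdWeight α β γ (f t x) * score f t x k := by
    filter_upwards [hω.mem_nhds hθ] with t ht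
    rw [h.fderiv_epdB' α β γ hω ht, inner_stdVec]
    simp [epdT]
  rw [heq.fderiv_eq]
  have hw := (hasDerivAt_epdWeight α β γ (hpos θ hθ)).comp_hasFDerivAt θ (h.hasFDerivAt hω hθ)
  have hs : DifferentiableAt ℝ (fun t => score f t x k) θ := by
    have h1 : ContDiffAt ℝ 3 (fun t => Real.log (f t x)) θ :=
      (h.contDiffAt hω hθ).log (hpos θ hθ).ne'
    have h2 : DifferentiableAt ℝ (fderiv ℝ fun t => Real.log (f t x)) θ :=
      (h1.fderiv_right (m := 1) (by norm_num)).differentiableAt (by norm_num)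
    have h3 : (fun t => score f t x k) =
        fun t => fderiv ℝ (fun t => Real.log (f t x)) t (stdVec k) := by
      ext t
      rw [← inner_stdVec, score, inner_gradient_left]
    rw [h3]
    exact h2.clm_apply (differentiableAt_const _)
  have h4 := hw.mul hs.hasFDerivAt
  have h5 : fderiv ℝ (fun t => epdWeight α β γ (f t x) * score f t x k) θ = _ := h4.fderiv
  have hf := (hpos θ hθ).ne'
  rw [h5]
  simp only [_root_.add_apply, _root_.smul_apply, h.fderiv_density hω hθ, inner_stdVec,
    infoMatrix, Matrix.of_apply, smul_eq_mul, Function.comp_apply]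
  field_simp
  ring

/-- The integrand of the matrix `J` in terms of second derivatives. -/
theorem iteratedFDeriv_sub_eq_sum_epdJTerm (h : IsSmoothModelAt f ω x) (hω : IsOpen ω)
    (hθ : θ ∈ ω) {g : 𝒳 → ℝ} (hg : (∀ θ ∈ ω, f θ x = 0) → g x = 0) (k l : Fin p) :
    iteratedFDeriv ℝ 2 (fun t => epdB' α β γ (f t x) * f t x - epdB α β γ (f t x)) θ
        ![stdVec l, stdVec k] -
      g x * iteratedFDeriv ℝ 2 (fun t => epdB' α β γ (f t x)) θ ![stdVec l, stdVec k] =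
      ∑ i, epdJTerm α β γ f g θ k l x i := by
  rcases h.pos_or_zero with hpos | hzero
  · have hC := (h.contDiffAt_epdB' α β γ hω hθ).of_le (by norm_num : (2 : WithTop ℕ∞) ≤ 3)
    have heq : (fun t => fderiv ℝ (fun t => epdB' α β γ (f t x) * f t x - epdB α β γ (f t x)) t
          (stdVec k)) =ᶠ[𝓝 θ]
        fun t => f t x * fderiv ℝ (fun t => epdB' α β γ (f t x)) t (stdVec k) := by
      filter_upwards [hω.mem_nhds hθ] with t ht
      rw [h.fderiv_epdB' α β γ hω ht, h.fderiv_integrand α β γ hω ht]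
    have hd : DifferentiableAt ℝ
        (fun t => fderiv ℝ (fun t => epdB' α β γ (f t x)) t (stdVec k)) θ :=
      ((hC.fderiv_right (m := 1) (by norm_num)).differentiableAt (by norm_num)).clm_apply
        (differentiableAt_const _)
    have h1 : iteratedFDeriv ℝ 2 (fun t => epdB' α β γ (f t x) * f t x - epdB α β γ (f t x)) θ
        ![stdVec l, stdVec k] =
        f θ x * iteratedFDeriv ℝ 2 (fun t => epdB' α β γ (f t x)) θ ![stdVec l, stdVec k] +
        epdWeight α β γ (f θ x) * score f θ x k * (f θ x * score f θ x l) := by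
      rw [iteratedFDeriv_two_apply_of_contDiffAt
        ((h.contDiffAt_integrand α β γ hω hθ).of_le (by norm_num)), heq.fderiv_eq,
        fderiv_fun_mul (h.hasFDerivAt hω hθ).differentiableAt hd,
        iteratedFDeriv_two_apply_of_contDiffAt hC]
      simp only [_root_.add_apply, _root_.smul_apply, smul_eq_mul, h.fderiv_density hω hθ,
        h.fderiv_epdB' α β γ hω hθ, inner_stdVec, epdT, PiLp.smul_apply]
    rw [h1, h.iteratedFDeriv_epdB' α β γ hω hθ hpos]
    simp only [epdJTerm, Fin.sum_univ_five, epdWeight, Matrix.cons_val,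
      Real.rpow_add_one (hpos θ hθ).ne']
    ring
  · have h0 : (fun t => epdB' α β γ (f t x) * f t x - epdB α β γ (f t x)) =ᶠ[𝓝 θ]
        fun _ => epdB' α β γ 0 * 0 - epdB α β γ 0 := by
      filter_upwards [hω.mem_nhds hθ] with t ht
      rw [hzero t ht]
    rw [(h0.iteratedFDeriv ℝ 2).self_of_nhds, hg hzero]
    simp [epdJTerm, Fin.sum_univ_five, hzero θ hθ, hg hzero, iteratedFDeriv_const_of_ne,
      score_eq_zero hzero hω hθ]

theorem iteratedFDeriv_epdB'_mul (hx : IsSmoothModelAt f ω x)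
    {g : 𝒳 → ℝ} (hω : IsOpen ω) (hθ : θ ∈ ω) {n : ℕ} (hn : n ≤ 3)
    (v : Fin n → EuclideanSpace ℝ (Fin p)) :
    iteratedFDeriv ℝ n (fun t => epdB' α β γ (f t x) * g x) θ v =
      g x • iteratedFDeriv ℝ n (fun t => epdB' α β γ (f t x)) θ v := by
  have h1 : (fun t => epdB' α β γ (f t x) * g x) = fun t => g x • epdB' α β γ (f t x) := by
    ext t
    rw [smul_eq_mul, mul_comm]
  rw [h1, iteratedFDeriv_const_smul_apply' ((hx.contDiffAt_epdB' α β γ hω hθ).of_le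
    (by exact_mod_cast hn))]
  rfl

end IsSmoothModelAt

end Model

/-! ### Bounds on derivatives from bounds on partial derivatives -/

section Bounds

variable {p : ℕ}

theorem clm_apply_eq_sum (L : EuclideanSpace ℝ (Fin p) →L[ℝ] ℝ) (v : EuclideanSpace ℝ (Fin p)) :
    L v = ∑ k, v k * L (stdVec k) := by
  have h : v = ∑ k, v k • stdVec k := by
    simpa using ((EuclideanSpace.basisFun (Fin p) ℝ).sum_repr v).symm
  conv_lhs => rw [h]
  simp

theorem norm_clm_le_sum (L : EuclideanSpace ℝ (Fin p) →L[ℝ] ℝ) :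
    ‖L‖ ≤ ∑ k, |L (stdVec k)| := by
  refine L.opNorm_le_bound (Finset.sum_nonneg fun k _ => abs_nonneg _) fun v => ?_
  rw [clm_apply_eq_sum, Finset.sum_mul]
  refine (norm_sum_le _ _).trans (Finset.sum_le_sum fun k _ => ?_)
  rw [norm_mul, mul_comm, Real.norm_eq_abs (L _)]
  gcongr
  exact PiLp.norm_apply_le v k

theorem norm_le_sum_abs (v : EuclideanSpace ℝ (Fin p)) : ‖v‖ ≤ ∑ k, |v k| := by
  have h : v = ∑ k, v k • stdVec k := by
    simpa using ((EuclideanSpace.basisFun (Fin p) ℝ).sum_repr v).symm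
  conv_lhs => rw [h]
  refine (norm_sum_le _ _).trans (Finset.sum_le_sum fun k _ => ?_)
  simp [norm_smul]

/-- A bound on the third partial derivatives controls the error of linearizing the partial
derivatives `∂_l F` at `θ₀`. -/
theorem abs_partial_sub_sub_le {F : EuclideanSpace ℝ (Fin p) → ℝ}
    {ω : Set (EuclideanSpace ℝ (Fin p))} {θ₀ : EuclideanSpace ℝ (Fin p)} {ρ : ℝ} (hω : IsOpen ω)
    (hball : Metric.closedBall θ₀ ρ ⊆ ω) (hF : ∀ θ ∈ ω, ContDiffAt ℝ 2 F θ)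
    (hF₂ : DifferentiableOn ℝ (iteratedFDeriv ℝ 2 F) ω) {M : Fin p → Fin p → Fin p → ℝ}
    (hM : ∀ θ ∈ ω, ∀ j k l,
      |iteratedFDeriv ℝ 3 F θ ![stdVec j, stdVec k, stdVec l]| ≤ M j k l)
    {θ θ' : EuclideanSpace ℝ (Fin p)} (hθ : θ ∈ Metric.closedBall θ₀ ρ)
    (hθ' : θ' ∈ Metric.closedBall θ₀ ρ) (l : Fin p) :
    |fderiv ℝ F θ (stdVec l) - fderiv ℝ F θ' (stdVec l) -
      ∑ k, (θ - θ') k * iteratedFDeriv ℝ 2 F θ₀ ![stdVec k, stdVec l]| ≤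
      (∑ k, ∑ j, M j k l) * ρ * ‖θ - θ'‖ := by
  have hρ : 0 ≤ ρ := dist_nonneg.trans (Metric.mem_closedBall.1 hθ)
  have h0 : θ₀ ∈ Metric.closedBall θ₀ ρ := Metric.mem_closedBall_self hρ
  set D : EuclideanSpace ℝ (Fin p) → ℝ := fun t => fderiv ℝ F t (stdVec l) with hD
  have hDd : ∀ t ∈ ω, HasFDerivAt D (fderiv ℝ D t) t := fun t ht =>
    ((((hF t ht).fderiv_right (m := 1) (by norm_num)).differentiableAt (by norm_num)).clm_apply
      (differentiableAt_const _)).hasFDerivAt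
  have hDk : ∀ t ∈ ω, ∀ u, fderiv ℝ D t u = iteratedFDeriv ℝ 2 F t ![u, stdVec l] :=
    fun t ht u => (iteratedFDeriv_two_apply_of_contDiffAt (hF t ht) u _).symm
  have hsecond : ∀ k, ∀ t ∈ Metric.closedBall θ₀ ρ,
      |iteratedFDeriv ℝ 2 F t ![stdVec k, stdVec l] -
        iteratedFDeriv ℝ 2 F θ₀ ![stdVec k, stdVec l]| ≤ (∑ j, M j k l) * ρ := by
    intro k t ht
    have hder : ∀ s ∈ Metric.closedBall θ₀ ρ, HasFDerivWithinAt
        (fun s => iteratedFDeriv ℝ 2 F s ![stdVec k, stdVec l])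
        ((ContinuousMultilinearMap.apply ℝ (fun _ : Fin 2 => EuclideanSpace ℝ (Fin p)) ℝ
          ![stdVec k, stdVec l]) ∘L fderiv ℝ (iteratedFDeriv ℝ 2 F) s)
        (Metric.closedBall θ₀ ρ) s := by
      intro s hs
      have h1 := ((hF₂ s (hball hs)).differentiableAt (hω.mem_nhds (hball hs))).hasFDerivAt
      exact ((ContinuousMultilinearMap.apply ℝ (fun _ : Fin 2 => EuclideanSpace ℝ (Fin p)) ℝ
          ![stdVec k, stdVec l]).hasFDerivAt.comp s h1).hasFDerivWithinAt
    have hbd : ∀ s ∈ Metric.closedBall θ₀ ρ,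
        ‖(ContinuousMultilinearMap.apply ℝ (fun _ : Fin 2 => EuclideanSpace ℝ (Fin p)) ℝ
          ![stdVec k, stdVec l]) ∘L fderiv ℝ (iteratedFDeriv ℝ 2 F) s‖ ≤ ∑ j, M j k l := by
      intro s hs
      refine (norm_clm_le_sum _).trans (Finset.sum_le_sum fun j _ => ?_)
      have h1 := hM s (hball hs) j k l
      rw [iteratedFDeriv_succ_apply_left] at h1
      exact h1
    have hmv := (convex_closedBall θ₀ ρ).norm_image_sub_le_of_norm_hasFDerivWithin_le hder hbd h0 ht
    refine hmv.trans ?_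
    have hnn : 0 ≤ ∑ j, M j k l := (norm_nonneg _).trans (hbd θ₀ h0)
    gcongr
    exact mem_closedBall_iff_norm.1 ht
  have hbound : ∀ t ∈ Metric.closedBall θ₀ ρ,
      ‖fderiv ℝ D t - fderiv ℝ D θ₀‖ ≤ (∑ k, ∑ j, M j k l) * ρ := by
    intro t ht
    refine (norm_clm_le_sum _).trans ?_
    rw [Finset.sum_mul]
    refine Finset.sum_le_sum fun k _ => ?_
    rw [_root_.sub_apply, hDk t (hball ht), hDk θ₀ (hball h0)]
    exact hsecond k t ht
  have hfin := (convex_closedBall θ₀ ρ).norm_image_sub_le_of_norm_hasFDerivWithin_le'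
    (fun t ht => (hDd t (hball ht)).hasFDerivWithinAt) hbound hθ' hθ
  rw [clm_apply_eq_sum] at hfin
  simp only [hDk θ₀ (hball h0)] at hfin
  exact hfin

end Bounds

/-! ### The estimating function as a gradient -/

section EstimatingFunction

variable {p : ℕ} {𝒳 : Type*} [MeasurableSpace 𝒳] {μ : Measure 𝒳} {α β γ : ℝ}
  {f : EuclideanSpace ℝ (Fin p) → 𝒳 → ℝ} {ω : Set (EuclideanSpace ℝ (Fin p))}
  {θ : EuclideanSpace ℝ (Fin p)}

namespace DiffThriceUnderIntegral

variable {h : EuclideanSpace ℝ (Fin p) → 𝒳 → ℝ}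

theorem contDiffAt (hh : DiffThriceUnderIntegral μ h ω) (hω : IsOpen ω) (hθ : θ ∈ ω) :
    ContDiffAt ℝ 2 (fun t => ∫ x, h t x ∂μ) θ := by
  have h2 : ContDiffOn ℝ (2 : ℕ∞) (fun t => ∫ x, h t x ∂μ) ω := by
    refine contDiffOn_of_differentiableOn fun m hm => ?_
    have hm' : m ≤ 2 := by exact_mod_cast hm
    exact (hh.differentiableOn m (by omega)).congr (iteratedFDerivWithin_of_isOpen m hω)
  exact h2.contDiffAt (hω.mem_nhds hθ)

theorem integrable_fderiv (hh : DiffThriceUnderIntegral μ h ω) (hθ : θ ∈ ω)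
    (v : EuclideanSpace ℝ (Fin p)) : Integrable (fun x => fderiv ℝ (fun t => h t x) θ v) μ := by
  simpa using hh.integrable 1 (by norm_num) θ hθ fun _ => v

theorem fderiv_integral (hh : DiffThriceUnderIntegral μ h ω) (hθ : θ ∈ ω)
    (v : EuclideanSpace ℝ (Fin p)) :
    fderiv ℝ (fun t => ∫ x, h t x ∂μ) θ v = ∫ x, fderiv ℝ (fun t => h t x) θ v ∂μ := by
  simpa using hh.iteratedFDeriv_integral 1 (by norm_num) θ hθ fun _ => v

end DiffThriceUnderIntegral

theorem integrable_density_mul_epdT (hω : IsOpen ω)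
    (hsm : ∀ᵐ x ∂μ, IsSmoothModelAt f ω x)
    (hint₁ : DiffThriceUnderIntegral μ
      (fun θ x => epdB' α β γ (f θ x) * f θ x - epdB α β γ (f θ x)) ω) (hθ : θ ∈ ω)
    (k : Fin p) : Integrable (fun x => (f θ x • epdT α β γ f θ x) k) μ := by
  refine (hint₁.integrable_fderiv hθ (stdVec k)).congr ?_
  filter_upwards [hsm] with x hx
  rw [hx.fderiv_integrand α β γ hω hθ, inner_stdVec]
  simp

theorem fderiv_integral_integrand (hω : IsOpen ω) (hsm : ∀ᵐ x ∂μ, IsSmoothModelAt f ω x)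
    (hint₁ : DiffThriceUnderIntegral μ
      (fun θ x => epdB' α β γ (f θ x) * f θ x - epdB α β γ (f θ x)) ω) (hθ : θ ∈ ω)
    (v : EuclideanSpace ℝ (Fin p)) :
    fderiv ℝ (fun t => ∫ x, (epdB' α β γ (f t x) * f t x - epdB α β γ (f t x)) ∂μ) θ v =
      inner ℝ (∫ x, f θ x • epdT α β γ f θ x ∂μ) v := by
  have hI : Integrable (fun x => f θ x • epdT α β γ f θ x) μ :=
    Integrable.of_eval_piLp (integrable_density_mul_epdT hω hsm hint₁ hθ)
  rw [hint₁.fderiv_integral hθ, real_inner_comm, ← integral_inner hI]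
  refine integral_congr_ae ?_
  filter_upwards [hsm] with x hx
  rw [hx.fderiv_integrand α β γ hω hθ, inner_smul_right, real_inner_comm]

theorem contDiffAt_epdV (hω : IsOpen ω)
    (hint₁ : DiffThriceUnderIntegral μ
      (fun θ x => epdB' α β γ (f θ x) * f θ x - epdB α β γ (f θ x)) ω) (hθ : θ ∈ ω) {x : 𝒳}
    (hx : IsSmoothModelAt f ω x) : ContDiffAt ℝ 2 (fun t => epdV μ α β γ f t x) θ :=
  (hint₁.contDiffAt hω hθ).sub ((hx.contDiffAt_epdB' α β γ hω hθ).of_le (by norm_num))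

theorem iteratedFDeriv_two_epdV (hω : IsOpen ω)
    (hint₁ : DiffThriceUnderIntegral μ
      (fun θ x => epdB' α β γ (f θ x) * f θ x - epdB α β γ (f θ x)) ω) (hθ : θ ∈ ω) {x : 𝒳}
    (hx : IsSmoothModelAt f ω x) :
    iteratedFDeriv ℝ 2 (fun t => epdV μ α β γ f t x) θ =
      iteratedFDeriv ℝ 2
        (fun t => ∫ x, (epdB' α β γ (f t x) * f t x - epdB α β γ (f t x)) ∂μ) θ -
      iteratedFDeriv ℝ 2 (fun t => epdB' α β γ (f t x)) θ :=
  iteratedFDeriv_sub_apply (i := 2) (hint₁.contDiffAt hω hθ)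
    ((hx.contDiffAt_epdB' α β γ hω hθ).of_le (by norm_num))

theorem differentiableOn_iteratedFDeriv_epdV (hω : IsOpen ω)
    (hint₁ : DiffThriceUnderIntegral μ
      (fun θ x => epdB' α β γ (f θ x) * f θ x - epdB α β γ (f θ x)) ω) {x : 𝒳}
    (hx : IsSmoothModelAt f ω x) :
    DifferentiableOn ℝ (iteratedFDeriv ℝ 2 fun t => epdV μ α β γ f t x) ω := by
  have h1 : DifferentiableOn ℝ (iteratedFDeriv ℝ 2 fun t => epdB' α β γ (f t x)) ω := by
    intro t ht
    have h2 := (hx.contDiffAt_epdB' α β γ hω ht).iteratedFDeriv_right (i := 2) (m := 1)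
      (by norm_num)
    exact (h2.differentiableAt (by norm_num)).differentiableWithinAt
  exact ((hint₁.differentiableOn 2 (by norm_num)).sub h1).congr fun t ht =>
    iteratedFDeriv_two_epdV hω hint₁ ht hx

/-- The estimating function `ψ(x, θ)` is the negative gradient of the objective `V_θ(x)`. -/
theorem fderiv_epdV (hω : IsOpen ω) (hsm : ∀ᵐ x ∂μ, IsSmoothModelAt f ω x)
    (hint₁ : DiffThriceUnderIntegral μ
      (fun θ x => epdB' α β γ (f θ x) * f θ x - epdB α β γ (f θ x)) ω) (hθ : θ ∈ ω) {x : 𝒳}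
    (hx : IsSmoothModelAt f ω x) (v : EuclideanSpace ℝ (Fin p)) :
    fderiv ℝ (fun t => epdV μ α β γ f t x) θ v = -inner ℝ (epdPsi μ α β γ f x θ) v := by
  have h1 := ((hint₁.contDiffAt hω hθ).differentiableAt (by norm_num)).hasFDerivAt
  have h2 := ((hx.contDiffAt_epdB' α β γ hω hθ).differentiableAt (by norm_num)).hasFDerivAt
  have h3 : fderiv ℝ (fun t => epdV μ α β γ f t x) θ = _ := (h1.sub h2).fderiv
  rw [h3, _root_.sub_apply, fderiv_integral_integrand hω hsm hint₁ hθ,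
    hx.fderiv_epdB' α β γ hω hθ, epdPsi, inner_sub_left]
  ring

/-- The derivative of `ψ(x, ·)` at `θ`, i.e. the negative Hessian of `V_θ(x)`, as a linear map. -/
noncomputable def epdPsiDeriv (μ : Measure 𝒳) (α β γ : ℝ)
    (f : EuclideanSpace ℝ (Fin p) → 𝒳 → ℝ) (θ : EuclideanSpace ℝ (Fin p)) (x : 𝒳) :
    EuclideanSpace ℝ (Fin p) →L[ℝ] EuclideanSpace ℝ (Fin p) :=
  -Matrix.toEuclideanCLM (𝕜 := ℝ) (Matrix.of fun k l => epdV₂ μ α β γ f θ l k x)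

theorem norm_epdPsi_sub_sub_le (hω : IsOpen ω) (hsm : ∀ᵐ x ∂μ, IsSmoothModelAt f ω x)
    (hint₁ : DiffThriceUnderIntegral μ
      (fun θ x => epdB' α β γ (f θ x) * f θ x - epdB α β γ (f θ x)) ω)
    {θ₀ : EuclideanSpace ℝ (Fin p)} {ρ : ℝ} (hball : Metric.closedBall θ₀ ρ ⊆ ω) {x : 𝒳}
    (hx : IsSmoothModelAt f ω x) {M : Fin p → Fin p → Fin p → ℝ}
    (hM : ∀ j k l, ∀ θ ∈ ω, |epdV₃ μ α β γ f θ j k l x| ≤ M j k l)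
    {θ θ' : EuclideanSpace ℝ (Fin p)} (hθ : θ ∈ Metric.closedBall θ₀ ρ)
    (hθ' : θ' ∈ Metric.closedBall θ₀ ρ) :
    ‖epdPsi μ α β γ f x θ - epdPsi μ α β γ f x θ' - epdPsiDeriv μ α β γ f θ₀ x (θ - θ')‖ ≤
      (∑ l, ∑ k, ∑ j, M j k l) * ρ * ‖θ - θ'‖ := by
  refine (norm_le_sum_abs _).trans ?_
  rw [Finset.sum_mul, Finset.sum_mul]
  refine Finset.sum_le_sum fun l _ => ?_
  have h1 := abs_partial_sub_sub_le hω hball (fun t ht => contDiffAt_epdV hω hint₁ ht hx)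
    (differentiableOn_iteratedFDeriv_epdV hω hint₁ hx) (fun t ht j k l => hM j k l t ht) hθ hθ' l
  rw [fderiv_epdV hω hsm hint₁ (hball hθ) hx, fderiv_epdV hω hsm hint₁ (hball hθ') hx,
    inner_stdVec, inner_stdVec, ← abs_neg] at h1
  refine le_trans (le_of_eq ?_) h1
  congr 1
  simp only [epdPsiDeriv, PiLp.sub_apply, _root_.neg_apply, PiLp.neg_apply,
    Matrix.ofLp_toEuclideanCLM, Matrix.mulVec, dotProduct, Matrix.of_apply, epdV₂]
  simp only [mul_comm]
  ring

/-- On a measurable set of observations at which the model is smooth, `ψ(·, θ)` is measurable, as a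
limit of difference quotients of `B'(f_θ)`. -/
theorem measurable_indicator_epdPsi (hω : IsOpen ω) {S : Set 𝒳} (hS : MeasurableSet S)
    (hsm : ∀ x ∈ S, IsSmoothModelAt f ω x) (hf : ∀ θ ∈ ω, Measurable (f θ)) (hθ : θ ∈ ω) :
    Measurable (S.indicator fun x => epdPsi μ α β γ f x θ) := by
  have hT : ∀ k, Measurable (S.indicator fun x => epdT α β γ f θ x k) := by
    intro k
    have hev : ∀ᶠ n : ℕ in atTop, θ + (n : ℝ)⁻¹ • stdVec k ∈ ω := by
      have h1 : Tendsto (fun n : ℕ => θ + (n : ℝ)⁻¹ • stdVec k) atTop (𝓝 θ) := by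
        have h2 := (tendsto_inv_atTop_nhds_zero_nat (𝕜 := ℝ)).smul_const (stdVec k)
        simpa using h2.const_add θ
      exact h1.eventually (hω.mem_nhds hθ)
    obtain ⟨N, hN⟩ := eventually_atTop.1 hev
    refine measurable_of_tendsto_metrizable (f := fun (n : ℕ) => S.indicator fun x =>
      ((n + N : ℕ) : ℝ) * (epdB' α β γ (f (θ + ((n + N : ℕ) : ℝ)⁻¹ • stdVec k) x) -
        epdB' α β γ (f θ x))) (fun n => ?_) (tendsto_pi_nhds.2 fun x => ?_)
    · exact ((((measurable_epdB' α β γ).comp (hf _ (hN _ (by omega)))).sub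
        ((measurable_epdB' α β γ).comp (hf θ hθ))).const_mul _).indicator hS
    · by_cases hxS : x ∈ S
      · simp only [Set.indicator_of_mem hxS]
        have h1 := (((hsm x hxS).contDiffAt_epdB' α β γ hω hθ).differentiableAt
          (by norm_num)).hasFDerivAt.lim_real (stdVec k)
        rw [(hsm x hxS).fderiv_epdB' α β γ hω hθ, inner_stdVec] at h1
        exact h1.comp (tendsto_natCast_atTop_atTop.comp (tendsto_add_atTop_nat N))
      · simp only [Set.indicator_of_notMem hxS]
        exact tendsto_const_nhds
  have hT' : Measurable (S.indicator fun x => epdT α β γ f θ x) := by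
    have h1 : (S.indicator fun x => epdT α β γ f θ x) =
        fun x => WithLp.toLp 2 fun k => S.indicator (fun x => epdT α β γ f θ x k) x := by
      ext x k
      by_cases hxS : x ∈ S <;> simp [hxS]
    rw [h1]
    exact (WithLp.measurable_toLp 2 _).comp (measurable_pi_lambda _ hT)
  have h2 : (S.indicator fun x => epdPsi μ α β γ f x θ) =
      (S.indicator fun x => epdT α β γ f θ x) -
        S.indicator fun _ => ∫ y, f θ y • epdT α β γ f θ y ∂μ := by
    ext1 x
    by_cases hxS : x ∈ S <;> simp [hxS, epdPsi]
  rw [h2]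
  exact hT'.sub (measurable_const.indicator hS)

end EstimatingFunction

/-! ### Random vectors and matrices -/

section VectorIntegrals

variable {p : ℕ} {𝒳 : Type*} [MeasurableSpace 𝒳] {ν : Measure 𝒳}

theorem toEuclideanCLM_eq_sum (A : Matrix (Fin p) (Fin p) ℝ) :
    Matrix.toEuclideanCLM (𝕜 := ℝ) A =
      ∑ k, ∑ l, A k l • Matrix.toEuclideanCLM (𝕜 := ℝ) (Matrix.single k l 1) := by
  conv_lhs => rw [Matrix.matrix_eq_sum_single A]
  simp only [map_sum]
  refine Finset.sum_congr rfl fun k _ => Finset.sum_congr rfl fun l _ => ?_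
  rw [← map_smul, Matrix.smul_single, smul_eq_mul, mul_one]

theorem integrable_toEuclideanCLM {A : 𝒳 → Matrix (Fin p) (Fin p) ℝ}
    (hA : ∀ k l, Integrable (fun x => A x k l) ν) :
    Integrable (fun x => Matrix.toEuclideanCLM (𝕜 := ℝ) (A x)) ν :=
  (integrable_finsetSum _ fun k _ => integrable_finsetSum _ fun l _ =>
    (hA k l).smul_const (Matrix.toEuclideanCLM (𝕜 := ℝ) (Matrix.single k l 1))).congr
    (Eventually.of_forall fun x => (toEuclideanCLM_eq_sum (A x)).symm)

theorem integral_toEuclideanCLM {A : 𝒳 → Matrix (Fin p) (Fin p) ℝ}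
    (hA : ∀ k l, Integrable (fun x => A x k l) ν) :
    ∫ x, Matrix.toEuclideanCLM (𝕜 := ℝ) (A x) ∂ν =
      Matrix.toEuclideanCLM (𝕜 := ℝ) (Matrix.of fun k l => ∫ x, A x k l ∂ν) := by
  have h : ∀ k l, Integrable
      (fun x => A x k l • Matrix.toEuclideanCLM (𝕜 := ℝ) (Matrix.single k l (1 : ℝ))) ν :=
    fun k l => (hA k l).smul_const _
  rw [toEuclideanCLM_eq_sum, integral_congr_ae (Eventually.of_forall fun x =>
    toEuclideanCLM_eq_sum (A x)), integral_finsetSum _ fun k _ => integrable_finsetSum _ fun l _ =>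
    h k l]
  refine Finset.sum_congr rfl fun k _ => ?_
  rw [integral_finsetSum _ fun l _ => h k l]
  refine Finset.sum_congr rfl fun l _ => ?_
  rw [integral_smul_const, Matrix.of_apply]

theorem memLp_two_of_integrable_mul {Y : 𝒳 → EuclideanSpace ℝ (Fin p)}
    (hm : AEStronglyMeasurable Y ν) (hY : ∀ k l, Integrable (fun x => Y x k * Y x l) ν) :
    MemLp Y 2 ν := by
  rw [memLp_two_iff_integrable_sq_norm hm]
  simp_rw [EuclideanSpace.real_norm_sq_eq, sq]
  exact integrable_finsetSum _ fun k _ => hY k k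

theorem integral_inner_sq {Y : 𝒳 → EuclideanSpace ℝ (Fin p)}
    (hY : ∀ k l, Integrable (fun x => Y x k * Y x l) ν) (t : EuclideanSpace ℝ (Fin p)) :
    ∫ x, inner ℝ (Y x) t ^ 2 ∂ν =
      t ⬝ᵥ (Matrix.of fun k l => ∫ x, Y x k * Y x l ∂ν) *ᵥ t := by
  have h1 : ∀ x, inner ℝ (Y x) t ^ 2 = ∑ k, ∑ l, t k * (Y x k * Y x l * t l) := by
    intro x
    rw [sq, PiLp.inner_apply, Finset.sum_mul_sum]
    refine Finset.sum_congr rfl fun k _ => Finset.sum_congr rfl fun l _ => ?_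
    simp only [RCLike.inner_apply, conj_trivial]
    ring
  simp_rw [h1]
  rw [integral_finsetSum _ fun k _ => integrable_finsetSum _ fun l _ =>
    ((hY k l).mul_const _).const_mul _]
  simp only [dotProduct, Matrix.mulVec, Matrix.of_apply, Finset.mul_sum]
  refine Finset.sum_congr rfl fun k _ => ?_
  rw [integral_finsetSum _ fun l _ => ((hY k l).mul_const _).const_mul _]
  refine Finset.sum_congr rfl fun l _ => ?_
  rw [integral_const_mul, integral_mul_const]

end VectorIntegrals

/-! ### Expectations under the true density -/

section TrueDensity

variable {p : ℕ} {𝒳 : Type*} [MeasurableSpace 𝒳] {μ : Measure 𝒳} {α β γ : ℝ}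
  {f : EuclideanSpace ℝ (Fin p) → 𝒳 → ℝ} {g : 𝒳 → ℝ}
  {Θ ω : Set (EuclideanSpace ℝ (Fin p))} {χ : Set 𝒳}
  {θ : EuclideanSpace ℝ (Fin p)}

/-- The measure with density `g`. -/
noncomputable abbrev densityMeasure (μ : Measure 𝒳) (g : 𝒳 → ℝ) : Measure 𝒳 :=
  μ.withDensity fun x => ENNReal.ofReal (g x)

namespace IsProbDensity

theorem isProbabilityMeasure (hg : IsProbDensity μ g) :
    IsProbabilityMeasure (densityMeasure μ g) :=
  ⟨by rw [withDensity_apply _ MeasurableSet.univ, Measure.restrict_univ, hg.lintegral_eq_one]⟩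

theorem integrable_iff {F : Type*} [NormedAddCommGroup F] [NormedSpace ℝ F]
    (hg : IsProbDensity μ g) {φ : 𝒳 → F} :
    Integrable φ (densityMeasure μ g) ↔ Integrable (fun x => g x • φ x) μ := by
  rw [integrable_withDensity_iff_integrable_smul' hg.measurable.ennreal_ofReal (by simp)]
  simp only [ENNReal.toReal_ofReal (hg.nonneg _)]

theorem integral_eq {F : Type*} [NormedAddCommGroup F] [NormedSpace ℝ F]
    (hg : IsProbDensity μ g) (φ : 𝒳 → F) :
    ∫ x, φ x ∂densityMeasure μ g = ∫ x, g x • φ x ∂μ := by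
  rw [integral_withDensity_eq_integral_toReal_smul hg.measurable.ennreal_ofReal (by simp)]
  simp only [ENNReal.toReal_ofReal (hg.nonneg _)]

theorem ae_pos (hg : IsProbDensity μ g) : ∀ᵐ x ∂densityMeasure μ g, 0 < g x := by
  rw [ae_withDensity_iff hg.measurable.ennreal_ofReal]
  refine Eventually.of_forall fun x hx => ?_
  simpa using hx

end IsProbDensity

theorem ae_isSmoothModelAt (hf : ∀ θ ∈ Θ, IsProbDensity μ (f θ)) (hg : IsProbDensity μ g)
    (hfχ : ∀ θ ∈ Θ, {x | 0 < f θ x} = χ) (hgχ : {x | 0 < g x} = χ) (hωΘ : ω ⊆ Θ)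
    (hsmooth : ∀ᵐ x ∂(μ.restrict χ), ContDiffOn ℝ 3 (fun θ => f θ x) ω) :
    ∀ᵐ x ∂μ, IsSmoothModelAt f ω x := by
  have hχ : MeasurableSet χ := hgχ ▸ measurableSet_lt measurable_const hg.measurable
  rw [ae_restrict_iff' hχ] at hsmooth
  filter_upwards [hsmooth] with x hx
  by_cases hxχ : x ∈ χ
  · exact ⟨hx hxχ, Or.inl fun θ hθ => (Set.ext_iff.1 (hfχ θ (hωΘ hθ)) x).2 hxχ⟩
  · have h0 : ∀ θ ∈ ω, f θ x = 0 := fun θ hθ =>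
      le_antisymm (not_lt.1 fun h => hxχ ((Set.ext_iff.1 (hfχ θ (hωΘ hθ)) x).1 h))
        ((hf θ (hωΘ hθ)).nonneg x)
    exact ⟨contDiffOn_const.congr h0, Or.inr h0⟩

theorem integrable_iteratedFDeriv_epdB' (hω : IsOpen ω)
    (hsm : ∀ᵐ x ∂μ, IsSmoothModelAt f ω x) (hg : IsProbDensity μ g)
    (hint₂ : DiffThriceUnderIntegral μ (fun θ x => epdB' α β γ (f θ x) * g x) ω) (hθ : θ ∈ ω)
    {n : ℕ} (hn : n ≤ 3) (v : Fin n → EuclideanSpace ℝ (Fin p)) :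
    Integrable (fun x => iteratedFDeriv ℝ n (fun t => epdB' α β γ (f t x)) θ v)
      (densityMeasure μ g) := by
  refine hg.integrable_iff.2 ((hint₂.integrable n hn θ hθ v).congr ?_)
  filter_upwards [hsm] with x hx
  exact hx.iteratedFDeriv_epdB'_mul α β γ hω hθ hn v

theorem integrable_epdT_apply (hω : IsOpen ω)
    (hsm : ∀ᵐ x ∂μ, IsSmoothModelAt f ω x) (hg : IsProbDensity μ g)
    (hint₂ : DiffThriceUnderIntegral μ (fun θ x => epdB' α β γ (f θ x) * g x) ω) (hθ : θ ∈ ω)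
    (k : Fin p) : Integrable (fun x => epdT α β γ f θ x k) (densityMeasure μ g) := by
  refine (integrable_iteratedFDeriv_epdB' hω hsm hg hint₂ hθ (n := 1) (by norm_num)
    fun _ => stdVec k).congr ?_
  filter_upwards [(withDensity_absolutelyContinuous μ _).ae_le hsm] with x hx
  rw [iteratedFDeriv_one_apply, hx.fderiv_epdB' α β γ hω hθ, inner_stdVec]

theorem integrable_epdV₂ (hω : IsOpen ω)
    (hsm : ∀ᵐ x ∂μ, IsSmoothModelAt f ω x) (hg : IsProbDensity μ g)
    (hint₁ : DiffThriceUnderIntegral μ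
      (fun θ x => epdB' α β γ (f θ x) * f θ x - epdB α β γ (f θ x)) ω)
    (hint₂ : DiffThriceUnderIntegral μ (fun θ x => epdB' α β γ (f θ x) * g x) ω) (hθ : θ ∈ ω)
    (k l : Fin p) : Integrable (fun x => epdV₂ μ α β γ f θ k l x) (densityMeasure μ g) := by
  have := hg.isProbabilityMeasure
  refine ((integrable_const (iteratedFDeriv ℝ 2 (fun t => ∫ x, (epdB' α β γ (f t x) * f t x -
    epdB α β γ (f t x)) ∂μ) θ ![stdVec k, stdVec l])).sub
    (integrable_iteratedFDeriv_epdB' hω hsm hg hint₂ hθ (n := 2) (by norm_num)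
      ![stdVec k, stdVec l])).congr ?_
  filter_upwards [(withDensity_absolutelyContinuous μ _).ae_le hsm] with x hx
  rw [epdV₂, iteratedFDeriv_two_epdV hω hint₁ hθ hx]
  rfl

/-- The matrix `J(θ)` is the expected Hessian of the objective. -/
theorem epdJ_apply_eq_integral_epdV₂ (hω : IsOpen ω)
    (hsm : ∀ᵐ x ∂μ, IsSmoothModelAt f ω x) (hg : IsProbDensity μ g)
    (hzero : ∀ x, (∀ θ ∈ ω, f θ x = 0) → g x = 0)
    (hint₁ : DiffThriceUnderIntegral μ
      (fun θ x => epdB' α β γ (f θ x) * f θ x - epdB α β γ (f θ x)) ω)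
    (hint₂ : DiffThriceUnderIntegral μ (fun θ x => epdB' α β γ (f θ x) * g x) ω) (hθ : θ ∈ ω)
    (k l : Fin p) :
    epdJ μ α β γ f g θ k l = ∫ x, epdV₂ μ α β γ f θ l k x ∂densityMeasure μ g := by
  have := hg.isProbabilityMeasure
  have hI := integrable_iteratedFDeriv_epdB' hω hsm hg hint₂ hθ (n := 2) (by norm_num)
    ![stdVec l, stdVec k]
  have h1 : ∫ x, epdV₂ μ α β γ f θ l k x ∂densityMeasure μ g =
      iteratedFDeriv ℝ 2 (fun t => ∫ x, (epdB' α β γ (f t x) * f t x -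
        epdB α β γ (f t x)) ∂μ) θ ![stdVec l, stdVec k] -
      ∫ x, iteratedFDeriv ℝ 2 (fun t => epdB' α β γ (f t x)) θ ![stdVec l, stdVec k]
        ∂densityMeasure μ g := by
    have h2 : ∫ x, epdV₂ μ α β γ f θ l k x ∂densityMeasure μ g =
        ∫ x, (iteratedFDeriv ℝ 2 (fun t => ∫ x, (epdB' α β γ (f t x) * f t x -
          epdB α β γ (f t x)) ∂μ) θ ![stdVec l, stdVec k] -
          iteratedFDeriv ℝ 2 (fun t => epdB' α β γ (f t x)) θ ![stdVec l, stdVec k])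
          ∂densityMeasure μ g := by
      refine integral_congr_ae ?_
      filter_upwards [(withDensity_absolutelyContinuous μ _).ae_le hsm] with x hx
      rw [epdV₂, iteratedFDeriv_two_epdV hω hint₁ hθ hx]
      rfl
    rw [h2, integral_sub (integrable_const _) hI, integral_const]
    simp
  rw [h1, hint₁.iteratedFDeriv_integral 2 (by norm_num) θ hθ, hg.integral_eq,
    ← integral_sub (hint₁.integrable 2 (by norm_num) θ hθ _) (hg.integrable_iff.1 hI), epdJ,
    Matrix.of_apply]
  refine integral_congr_ae ?_
  filter_upwards [hsm] with x hx
  exact (hx.iteratedFDeriv_sub_eq_sum_epdJTerm α β γ hω hθ (hzero x) k l).symm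

/-- The matrix `J(θ)` is the transpose of `E_g[∇_{kl} V_θ(X)]`. -/
theorem epdJ_eq_transpose_epdExpHessian (hω : IsOpen ω)
    (hsm : ∀ᵐ x ∂μ, IsSmoothModelAt f ω x) (hg : IsProbDensity μ g)
    (hzero : ∀ x, (∀ θ ∈ ω, f θ x = 0) → g x = 0)
    (hint₁ : DiffThriceUnderIntegral μ
      (fun θ x => epdB' α β γ (f θ x) * f θ x - epdB α β γ (f θ x)) ω)
    (hint₂ : DiffThriceUnderIntegral μ (fun θ x => epdB' α β γ (f θ x) * g x) ω)
    (hθ : θ ∈ ω) : epdJ μ α β γ f g θ = (epdExpHessian μ α β γ f g θ)ᵀ := by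
  ext k l
  rw [epdJ_apply_eq_integral_epdV₂ hω hsm hg hzero hint₁ hint₂ hθ, Matrix.transpose_apply,
    epdExpHessian, Matrix.of_apply, hg.integral_eq]
  simp only [smul_eq_mul, mul_comm]

variable {θg : EuclideanSpace ℝ (Fin p)}

theorem integrable_epdPsi (hω : IsOpen ω)
    (hsm : ∀ᵐ x ∂μ, IsSmoothModelAt f ω x) (hg : IsProbDensity μ g)
    (hint₂ : DiffThriceUnderIntegral μ (fun θ x => epdB' α β γ (f θ x) * g x) ω)
    (hθ : θ ∈ ω) : Integrable (fun x => epdPsi μ α β γ f x θ) (densityMeasure μ g) := by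
  have := hg.isProbabilityMeasure
  exact (Integrable.of_eval_piLp (integrable_epdT_apply hω hsm hg hint₂ hθ)).sub
    (integrable_const _)

/-- At the best fitting parameter the estimating function has mean zero. -/
theorem integral_epdPsi (hω : IsOpen ω)
    (hsm : ∀ᵐ x ∂μ, IsSmoothModelAt f ω x) (hg : IsProbDensity μ g)
    (hint₂ : DiffThriceUnderIntegral μ (fun θ x => epdB' α β γ (f θ x) * g x) ω)
    (hθω : θg ∈ ω)
    (hθg : ∫ x, g x • epdT α β γ f θg x ∂μ = ∫ x, f θg x • epdT α β γ f θg x ∂μ) :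
    ∫ x, epdPsi μ α β γ f x θg ∂densityMeasure μ g = 0 := by
  have := hg.isProbabilityMeasure
  simp only [epdPsi]
  rw [integral_sub (Integrable.of_eval_piLp (integrable_epdT_apply hω hsm hg hint₂ hθω))
    (integrable_const _), hg.integral_eq, hθg]
  simp

section Covariance

variable (hω : IsOpen ω) (hsm : ∀ᵐ x ∂μ, IsSmoothModelAt f ω x) (hg : IsProbDensity μ g)
  (hint₂ : DiffThriceUnderIntegral μ (fun θ x => epdB' α β γ (f θ x) * g x) ω) (hθω : θg ∈ ω)
  (hθg : ∫ x, g x • epdT α β γ f θg x ∂μ = ∫ x, f θg x • epdT α β γ f θg x ∂μ)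
  (hK : ∀ k l, Integrable (fun x =>
    score f θg x k * score f θg x l * epdWeight α β γ (f θg x) ^ 2 * g x) μ)

include hω hsm hg hint₂ hθω hθg hK

/-- The matrix `K` consists of the second moments of the estimating function. -/
theorem integrable_and_integral_epdPsi_mul (k l : Fin p) :
    Integrable (fun x => epdPsi μ α β γ f x θg k * epdPsi μ α β γ f x θg l)
      (densityMeasure μ g) ∧
    ∫ x, epdPsi μ α β γ f x θg k * epdPsi μ α β γ f x θg l ∂densityMeasure μ g =
      epdK μ α β γ f g θg k l := by
  have := hg.isProbabilityMeasure
  have hT := integrable_epdT_apply hω hsm hg hint₂ hθω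
  set c := ∫ x, f θg x • epdT α β γ f θg x ∂μ with hc
  have hTT : Integrable (fun x => epdT α β γ f θg x k * epdT α β γ f θg x l)
      (densityMeasure μ g) := by
    refine hg.integrable_iff.2 ((hK k l).congr (Eventually.of_forall fun x => ?_))
    simp only [epdT, PiLp.smul_apply, smul_eq_mul]
    ring
  have hTTint : ∫ x, epdT α β γ f θg x k * epdT α β γ f θg x l ∂densityMeasure μ g =
      ∫ x, score f θg x k * score f θg x l * epdWeight α β γ (f θg x) ^ 2 * g x ∂μ := by
    rw [hg.integral_eq]
    congr 1
    ext x
    simp only [epdT, PiLp.smul_apply, smul_eq_mul]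
    ring
  have hTc : ∀ k, ∫ x, epdT α β γ f θg x k ∂densityMeasure μ g = c k := by
    intro k
    rw [← eval_integral_piLp hT k, hg.integral_eq, hθg]
  have hξ : ∀ k, epdXi μ α β γ f g θg k = c k := by
    intro k
    rw [← hTc k, hg.integral_eq, epdXi]
    congr 1
    ext x
    simp only [epdT, PiLp.smul_apply, smul_eq_mul]
    ring
  have hexp : (fun x => epdPsi μ α β γ f x θg k * epdPsi μ α β γ f x θg l) = fun x =>
      epdT α β γ f θg x k * epdT α β γ f θg x l -
        (c l * epdT α β γ f θg x k + c k * epdT α β γ f θg x l) + c k * c l := by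
    ext x
    simp only [epdPsi, PiLp.sub_apply, ← hc]
    ring
  have hI1 := ((hT k).const_mul (c l)).add ((hT l).const_mul (c k))
  rw [hexp]
  refine ⟨(hTT.sub hI1).add (integrable_const _), ?_⟩
  have e1 := integral_add (hTT.sub hI1) (integrable_const (c k * c l))
  have e2 := integral_sub hTT hI1
  have e3 := integral_add ((hT k).const_mul (c l)) ((hT l).const_mul (c k))
  simp only [Pi.sub_apply, Pi.add_apply] at e1 e2 e3
  rw [e1, e2, e3, integral_const_mul, integral_const_mul, hTc, hTc, hTTint, epdK, Matrix.of_apply,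
    hξ, hξ, integral_const]
  simp
  ring

theorem integral_inner_epdPsi_sq (t : EuclideanSpace ℝ (Fin p)) :
    ∫ x, inner ℝ (epdPsi μ α β γ f x θg) t ^ 2 ∂densityMeasure μ g =
      t ⬝ᵥ epdK μ α β γ f g θg *ᵥ t := by
  have h := integrable_and_integral_epdPsi_mul hω hsm hg hint₂ hθω hθg hK
  rw [integral_inner_sq fun k l => (h k l).1]
  have hKeq : (Matrix.of fun k l => ∫ x, epdPsi μ α β γ f x θg k * epdPsi μ α β γ f x θg l
      ∂densityMeasure μ g) = epdK μ α β γ f g θg := by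
    ext k l
    exact (h k l).2
  rw [hKeq]

theorem posSemidef_epdK : (epdK μ α β γ f g θg).PosSemidef := by
  refine Matrix.PosSemidef.of_dotProduct_mulVec_nonneg ?_ fun t => ?_
  · ext k l
    rw [Matrix.conjTranspose_apply, star_trivial, epdK, Matrix.of_apply, Matrix.of_apply,
      mul_comm (epdXi μ α β γ f g θg l)]
    simp only [mul_comm (score f θg _ l)]
  · have h := integral_inner_epdPsi_sq hω hsm hg hint₂ hθω hθg hK (WithLp.toLp 2 t)
    rw [star_trivial]
    exact h ▸ integral_nonneg fun x => sq_nonneg _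

end Covariance

/-- Under the assumptions on the model `ψ` is a regular estimating function near the best fitting
parameter. The set of full measure consists of observations at which the model is smooth and the
third derivatives of the objective are dominated. -/
theorem exists_regularEstimatingFunction (hf : ∀ θ ∈ Θ, IsProbDensity μ (f θ))
    (hg : IsProbDensity μ g)
    (hθg : ∫ x, g x • epdT α β γ f θg x ∂μ = ∫ x, f θg x • epdT α β γ f θg x ∂μ)
    (hgχ : {x | 0 < g x} = χ) (hω : IsOpen ω) (hωΘ : ω ⊆ Θ) (hθω : θg ∈ ω)
    (hsm : ∀ᵐ x ∂μ, IsSmoothModelAt f ω x)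
    (hzero : ∀ x, (∀ θ ∈ ω, f θ x = 0) → g x = 0)
    (hint₁ : DiffThriceUnderIntegral μ
      (fun θ x => epdB' α β γ (f θ x) * f θ x - epdB α β γ (f θ x)) ω)
    (hint₂ : DiffThriceUnderIntegral μ (fun θ x => epdB' α β γ (f θ x) * g x) ω)
    {M : Fin p → Fin p → Fin p → 𝒳 → ℝ}
    (hM : ∀ j k l, Integrable (fun x => M j k l x * g x) μ ∧
      ∀ᵐ x ∂(μ.restrict χ), ∀ θ ∈ ω, |epdV₃ μ α β γ f θ j k l x| ≤ M j k l x) :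
    ∃ r S, Metric.closedBall θg r ⊆ ω ∧
      RegularEstimatingFunction (densityMeasure μ g) (epdPsi μ α β γ f) θg r S
        (epdPsiDeriv μ α β γ f θg)
        (-Matrix.toEuclideanCLM (𝕜 := ℝ) (epdJ μ α β γ f g θg))
        (fun x => ∑ l, ∑ k, ∑ j, M j k l x) := by
  have hχ : MeasurableSet χ := hgχ ▸ measurableSet_lt measurable_const hg.measurable
  obtain ⟨r, hr, hball⟩ := Metric.nhds_basis_closedBall.mem_iff.1 (hω.mem_nhds hθω)
  have hac : densityMeasure μ g ≪ μ := withDensity_absolutelyContinuous μ _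
  -- the third derivatives are dominated almost surely, as the observations lie in `χ`
  have hgood : ∀ᵐ x ∂densityMeasure μ g, IsSmoothModelAt f ω x ∧
      ∀ j k l, ∀ θ ∈ ω, |epdV₃ μ α β γ f θ j k l x| ≤ M j k l x := by
    have h1 : ∀ᵐ x ∂μ, x ∈ χ → ∀ j k l, ∀ θ ∈ ω, |epdV₃ μ α β γ f θ j k l x| ≤ M j k l x := by
      rw [← ae_restrict_iff' hχ]
      exact ae_all_iff.2 fun j => ae_all_iff.2 fun k => ae_all_iff.2 fun l => (hM j k l).2
    filter_upwards [hac.ae_le hsm, hac.ae_le h1, hg.ae_pos] with x hx1 hx2 hx3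
    exact ⟨hx1, hx2 (hgχ ▸ hx3)⟩
  set N := toMeasurable (densityMeasure μ g) {x | ¬ (IsSmoothModelAt f ω x ∧
      ∀ j k l, ∀ θ ∈ ω, |epdV₃ μ α β γ f θ j k l x| ≤ M j k l x)} with hN
  have hS : ∀ x ∈ Nᶜ, IsSmoothModelAt f ω x ∧
      ∀ j k l, ∀ θ ∈ ω, |epdV₃ μ α β γ f θ j k l x| ≤ M j k l x := by
    intro x hx
    by_contra hcon
    exact hx (subset_toMeasurable _ _ hcon)
  have hV₂ : ∀ k l, Integrable
      (fun x => (Matrix.of fun k l => epdV₂ μ α β γ f θg l k x) k l) (densityMeasure μ g) :=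
    fun k l => integrable_epdV₂ hω hsm hg hint₁ hint₂ hθω l k
  refine ⟨r, Nᶜ, hball, ?_⟩
  exact
    { radius_pos := hr
      measurableSet := (measurableSet_toMeasurable _ _).compl
      ae_mem := by
        rw [ae_iff]
        simpa [hN, measure_toMeasurable] using ae_iff.1 hgood
      measurable_indicator := fun θ hθ => measurable_indicator_epdPsi hω
        (measurableSet_toMeasurable _ _).compl (fun x hx => (hS x hx).1)
        (fun θ hθ => (hf θ (hωΘ hθ)).measurable) (hball hθ)
      bound := fun x hx ρ hρ θ hθ θ' hθ' => norm_epdPsi_sub_sub_le hω hsm hint₁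
        ((Metric.closedBall_subset_closedBall hρ).trans hball) (hS x hx).1 (hS x hx).2 hθ hθ'
      integrable := integrable_epdPsi hω hsm hg hint₂ hθω
      integral_eq_zero := integral_epdPsi hω hsm hg hint₂ hθω hθg
      integrable_deriv := (integrable_toEuclideanCLM hV₂).neg
      integral_deriv := by
        simp only [epdPsiDeriv]
        rw [integral_neg, integral_toEuclideanCLM hV₂]
        congr 2
        ext k l
        exact (epdJ_apply_eq_integral_epdV₂ hω hsm hg hzero hint₁ hint₂ hθω k l).symm
      integrable_bound := by
        refine integrable_finsetSum _ fun l _ => integrable_finsetSum _ fun k _ =>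
          integrable_finsetSum _ fun j _ => ?_
        rw [hg.integrable_iff]
        simpa only [smul_eq_mul, mul_comm] using (hM j k l).1 }

end TrueDensity

/-! ### Consistency and asymptotic normality for the model -/

theorem neg_toEuclideanCLM_comp_neg {p : ℕ} {A B : Matrix (Fin p) (Fin p) ℝ} (h : A * B = 1) :
    (-Matrix.toEuclideanCLM (𝕜 := ℝ) A) ∘L (-Matrix.toEuclideanCLM (𝕜 := ℝ) B) = .id ℝ _ := by
  have h1 : Matrix.toEuclideanCLM (𝕜 := ℝ) A * Matrix.toEuclideanCLM (𝕜 := ℝ) B = 1 := by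
    rw [← map_mul, h, map_one]
  rw [ContinuousLinearMap.neg_comp, ContinuousLinearMap.comp_neg, neg_neg]
  exact h1

theorem theorem1 {p : ℕ} {𝒳 : Type*} [MeasurableSpace 𝒳] (μ : Measure 𝒳) [SigmaFinite μ]
    -- tuning parameters
    (α β γ : ℝ) (hβ : β ∈ Set.Icc (0 : ℝ) 1) (hγ : 0 ≤ γ)
    -- the parametric model and the true density
    (Θ : Set (EuclideanSpace ℝ (Fin p))) (f : EuclideanSpace ℝ (Fin p) → 𝒳 → ℝ) (g : 𝒳 → ℝ)
    (hf : ∀ θ ∈ Θ, IsProbDensity μ (f θ)) (hg : IsProbDensity μ g)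
    -- the best fitting parameter
    (θg : EuclideanSpace ℝ (Fin p))
    (hθg : ∫ x, g x • epdT α β γ f θg x ∂μ = ∫ x, f θg x • epdT α β γ f θg x ∂μ)
    -- common support
    (χ : Set 𝒳) (hfχ : ∀ θ ∈ Θ, {x | 0 < f θ x} = χ) (hgχ : {x | 0 < g x} = χ)
    -- smoothness on an open set of parameters containing the best fitting one
    (ω : Set (EuclideanSpace ℝ (Fin p))) (hωo : IsOpen ω) (hωΘ : ω ⊆ Θ) (hω : θg ∈ ω)
    (hsmooth : ∀ᵐ x ∂(μ.restrict χ), ContDiffOn ℝ 3 (fun θ => f θ x) ω)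
    -- differentiation under the integral sign
    (hint₁ : DiffThriceUnderIntegral μ
      (fun θ x => epdB' α β γ (f θ x) * f θ x - epdB α β γ (f θ x)) ω)
    (hint₂ : DiffThriceUnderIntegral μ (fun θ x => epdB' α β γ (f θ x) * g x) ω)
    -- positive definiteness
    (hpos : (epdExpHessian μ α β γ f g θg).PosDef)
    -- domination of the third derivatives
    (hdom : ∃ M : Fin p → Fin p → Fin p → 𝒳 → ℝ, ∀ j k l,
      Integrable (fun x => M j k l x * g x) μ ∧
      ∀ᵐ x ∂(μ.restrict χ), ∀ θ ∈ ω, |epdV₃ μ α β γ f θ j k l x| ≤ M j k l x)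
    -- the sample
    {Ω : Type*} [MeasurableSpace Ω] (P : Measure Ω) [IsProbabilityMeasure P] (X : ℕ → Ω → 𝒳)
    (hindep : iIndepFun X P)
    (hlaw : ∀ i, HasLaw (X i) (μ.withDensity fun x => ENNReal.ofReal (g x)) P) :
    -- (a) there is a consistent sequence of roots, given by measurable functions of the sample
    (∃ t : (n : ℕ) → (Fin n → 𝒳) → EuclideanSpace ℝ (Fin p), (∀ n, Measurable (t n)) ∧
      IsConsistentRootSeq P X Θ (epdPsi μ α β γ f) θg fun n w => t n fun i => X i w) ∧
    -- (b) if the integrals that define `K` exist, consistent sequences of roots are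
    -- asymptotically normal
    ((∀ k l, Integrable (fun x =>
        score f θg x k * score f θg x l * epdWeight α β γ (f θg x) ^ 2 * g x) μ) →
      IsUnit (epdJ μ α β γ f g θg).det ∧
      ((epdJ μ α β γ f g θg)⁻¹ * epdK μ α β γ f g θg * (epdJ μ α β γ f g θg)⁻¹).PosSemidef ∧
      ∀ θhat : ℕ → Ω → EuclideanSpace ℝ (Fin p), (∀ n, AEMeasurable (θhat n) P) →
        IsConsistentRootSeq P X Θ (epdPsi μ α β γ f) θg θhat →
        TendstoInDistribution (fun (n : ℕ) w => √(n : ℝ) • (θhat n w - θg)) atTop id (fun _ => P)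
          (multivariateGaussian 0
            ((epdJ μ α β γ f g θg)⁻¹ * epdK μ α β γ f g θg * (epdJ μ α β γ f g θg)⁻¹))) := by
  have hsm := ae_isSmoothModelAt hf hg hfχ hgχ hωΘ hsmooth
  -- off `χ` the true density vanishes together with the model
  have hzero : ∀ x, (∀ θ ∈ ω, f θ x = 0) → g x = 0 := by
    intro x hx
    refine le_antisymm (not_lt.1 fun hpos => ?_) (hg.nonneg x)
    have h1 : x ∈ {x | 0 < f θg x} := by
      rw [hfχ θg (hωΘ hω), ← hgχ]
      exact hpos
    exact h1.ne' (hx θg hω)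
  obtain ⟨M, hM⟩ := hdom
  obtain ⟨r, S, hball, hreg⟩ := exists_regularEstimatingFunction hf hg hθg hgχ hωo hωΘ hω hsm hzero
    hint₁ hint₂ hM
  set J := epdJ μ α β γ f g θg with hJ
  have hsymm : (epdExpHessian μ α β γ f g θg)ᵀ = epdExpHessian μ α β γ f g θg := by
    rw [← Matrix.conjTranspose_eq_transpose_of_trivial]
    exact hpos.isHermitian
  have hJpos : J.PosDef := by
    rw [hJ, epdJ_eq_transpose_epdExpHessian hωo hsm hg hzero hint₁ hint₂ hω, hsymm]
    exact hpos
  have hdet : IsUnit J.det := hJpos.det_pos.ne'.isUnit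
  have hBA := neg_toEuclideanCLM_comp_neg (Matrix.nonsing_inv_mul J hdet)
  have hAB := neg_toEuclideanCLM_comp_neg (Matrix.mul_nonsing_inv J hdet)
  constructor
  · obtain ⟨t, ht, hroot, hcons⟩ := hreg.exists_consistent_roots hBA hAB hindep hlaw
    exact ⟨t, ht, hroot.mono fun n w hw => ⟨hωΘ (hball hw.1), hw.2⟩, hcons⟩
  · intro hK
    have hinv : (J⁻¹)ᴴ = J⁻¹ := by
      rw [Matrix.conjTranspose_nonsing_inv, hJpos.isHermitian.eq]
    have hinvT : (J⁻¹)ᵀ = J⁻¹ := by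
      rw [← Matrix.conjTranspose_eq_transpose_of_trivial, hinv]
    have hpsd : (J⁻¹ * epdK μ α β γ f g θg * J⁻¹).PosSemidef := by
      have h1 := (posSemidef_epdK hωo hsm hg hint₂ hω hθg hK).mul_mul_conjTranspose_same J⁻¹
      rwa [hinv] at h1
    refine ⟨hdet, hpsd, fun θhat hmeas hroots => ?_⟩
    set B := -Matrix.toEuclideanCLM (𝕜 := ℝ) J⁻¹ with hB
    have hψ2 : MemLp (fun x => epdPsi μ α β γ f x θg) 2 (densityMeasure μ g) :=
      memLp_two_of_integrable_mul hreg.integrable.aestronglyMeasurable fun k l =>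
        (integrable_and_integral_epdPsi_mul hωo hsm hg hint₂ hω hθg hK k l).1
    refine hreg.tendstoInDistribution_of_roots hBA hindep hlaw ?_ hmeas
      (WithHighProb.mono hroots.root fun n w hw => hw.2) hroots.consistent
    -- the covariance matrix of `J⁻¹ ψ(X, θg)` is `J⁻¹ K J⁻¹`, as `J` is symmetric
    refine tendstoInDistribution_sqrt_smul_sampleMean hindep hlaw (B.comp_memLp' hψ2).neg ?_ hpsd
      fun t => ?_
    · simp only [Pi.neg_apply, Function.comp_apply]
      rw [integral_neg, B.integral_comp_comm hreg.integrable, hreg.integral_eq_zero]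
      simp
    · have h1 : ∀ x, inner ℝ (-B (epdPsi μ α β γ f x θg)) t =
          inner ℝ (epdPsi μ α β γ f x θg) (Matrix.toEuclideanCLM (𝕜 := ℝ) J⁻¹ t) := by
        intro x
        rw [hB, _root_.neg_apply, neg_neg, real_inner_comm, Matrix.inner_toEuclideanCLM,
          Matrix.inner_toEuclideanCLM, Matrix.dotProduct_mulVec, ← Matrix.mulVec_transpose, hinvT,
          dotProduct_comm]
      refine (integral_congr_ae (Eventually.of_forall fun x => congrArg (· ^ 2) (h1 x))).trans ?_
      rw [integral_inner_epdPsi_sq hωo hsm hg hint₂ hω hθg hK, Matrix.ofLp_toEuclideanCLM,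
        Matrix.mulVec_mulVec, dotProduct_comm, Matrix.dotProduct_mulVec, ← Matrix.mulVec_transpose,
        hinvT, dotProduct_comm, Matrix.mulVec_mulVec, ← Matrix.mul_assoc]
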